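/- **Setting.** A discrete memoryless channel with $N$ relays has finite input alphabets $\mathcal X,\mathcal X_1,\dots,\mathcal X_N$ (for the source and the relays), finite output alphabets $\mathcal Y,\mathcal Y_1,\dots,\mathcal Y_N$ (for the destination and the relays), and transition probabilities $p(y,y_1,\dots,y_N\mid x,x_1,\dots,x_N)$, applied independently at each time. A $(2^{nR},n)$ code has a message set $\mathcal W$ of $\lceil 2^{nR}\rceil$ elements, an encoder $f:\mathcal W\to\mathcal X^n$, relay functions $x_{i,k}=t_{i,k}(y_{i,1},\dots,y_{i,k-1})$ for $1\le i\le N$, $1\le k\le n$, and a decoder $g:\mathcal Y^n\to\mathcal W$. A rate $R$ is *achievable* if there is a sequence of $(2^{nR},n)$ codes, $n=1,2,\dots$, whose average error probability $\Pr(g(Y^n)\ne W)$, for $W$ uniform on $\mathcal W$, tends to $0$. All information quantities are in bits. **Theorem.** Fix distributions $p(x),p(x_1),\dots,p(x_N)$ and let $(X,X_1,\dots,X_N,Y,Y_1,\dots,Y_N)$ have the joint distribution $$p(x)\,p(x_1)\cdots p(x_N)\,p(y,y_1,\dots,y_N\mid x,x_1,\dots,x_N).$$ Write $\mathbf X=(X_1,\dots,X_N)$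 and $\mathbf Y_S=(Y_i)_{i\in S}$ for $S\subseteq\{1,\dots,N\}$. Let $\prec_X$ and $\prec_Y$ be any two strict partial orders on $\{1,\dots,N\}$ (the decoding order of the relay codewords and the decoding order of the relay compression indices), and put $$\tilde{\mathbf Z}_i=(X_j)_{j\prec_X i},\qquad T_i=\{j: j\prec_Y i\}.$$ For $S\subseteq T\subseteq\{1,\dots,N\}$ let $P_T(S)=\prod_{l\in S}q_l\prod_{l\in T\setminus S}(1-q_l)$, where the numbers $q_i\in[0,1]$ are determined recursively along $\prec_Y$ by $$q_i=\left[\frac{I(X_i;Y\mid\tilde{\mathbf Z}_i)}{H(Y_i\mid\mathbf X,Y)-\sum_{\varnothing\ne S\subseteq T_i}P_{T_i}(S)\,I(Y_i;\mathbf Y_S\mid\mathbf X,Y)}\right]^*,\qquad [x]^*=\min(x,1),$$ with $q_i=1$ if the denominator is $0$. Then every rate $R$ with $$R< I(X;Y\mid\mathbf X)+\sum_{\varnothing\ne\theta\subseteq\{1,\dots,N\}}P(\theta)\,I(X;\mathbf Y_\theta\mid\mathbf X,Y),\qquad P(\theta)=\prod_{i\in\theta}q_i\prod_{i\notin\theta}(1-q_i),$$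 is achievable. -/

import Mathlib

open Finset Filter Topology

noncomputable section

namespace MultiRelay

/-! ### Shannon information measures (in bits) on a finite probability space -/

section Information

variable {Ω α β γ : Type*} [Fintype Ω] [Fintype α] [Fintype β] [Fintype γ]

open Classical in
/-- The probability `P(U = a)` when the outcome `ω` has probability `P ω`. -/
def law (P : Ω → ℝ) (U : Ω → α) (a : α) : ℝ :=
  ∑ ω, if U ω = a then P ω else 0

/-- The conditional entropy `H(U | V) = -∑ p(u,v) log₂ (p(u,v) / p(v))`; terms with `p(u,v) = 0`
vanish. -/
def condEntropy (P : Ω → ℝ) (U : Ω → α) (V : Ω → β) : ℝ :=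
  -∑ u, ∑ v, law P (fun ω => (U ω, V ω)) (u, v) *
    Real.logb 2 (law P (fun ω => (U ω, V ω)) (u, v) / law P V v)

/-- The conditional mutual information `I(U; V | W) = H(U | W) - H(U | V, W)`. -/
def condMutualInfo (P : Ω → ℝ) (U : Ω → α) (V : Ω → β) (W : Ω → γ) : ℝ :=
  condEntropy P U W - condEntropy P U (fun ω => (V ω, W ω))

end Information

/-! ### The memoryless channel with `N` relays -/

/-- A discrete channel with `N` relays: `prob x xr (y, yr)` is the probability
`p(y, y₁, …, y_N | x, x₁, …, x_N)`. -/
structure RelayChannel {N : ℕ} (𝒳 𝒴 : Type*) (𝒳r 𝒴r : Fin N → Type*)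
    [Fintype 𝒴] [∀ i, Fintype (𝒴r i)] where
  /-- the transition probabilities -/
  prob : 𝒳 → (∀ i, 𝒳r i) → 𝒴 × (∀ i, 𝒴r i) → ℝ
  prob_mem : ∀ x xr, prob x xr ∈ stdSimplex ℝ (𝒴 × (∀ i, 𝒴r i))

/-- A block code of length `n` with `M` messages: an encoder, strictly causal relay functions
(at time `k` relay `i` sees the outputs that it received at the times before `k`), and a decoder
that sees the output at the destination. -/
structure RelayCode {N : ℕ} (𝒳 𝒴 : Type*) (𝒳r 𝒴r : Fin N → Type*) (M n : ℕ) where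
  /-- the encoder -/
  enc : Fin M → Fin n → 𝒳
  /-- the relay functions -/
  relay : ∀ (i : Fin N) (k : Fin n), (Fin (k : ℕ) → 𝒴r i) → 𝒳r i
  /-- the decoder -/
  dec : (Fin n → 𝒴) → Fin M

section Channel

variable {N : ℕ} {𝒳 𝒴 : Type*} {𝒳r 𝒴r : Fin N → Type*}
  [Fintype 𝒴] [∀ i, Fintype (𝒴r i)]

/-- The symbols that the relays send at time `k` if the channel outputs are `ω`. -/
def RelayCode.relayInput {M n : ℕ} (c : RelayCode 𝒳 𝒴 𝒳r 𝒴r M n)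
    (ω : Fin n → 𝒴 × (∀ i, 𝒴r i)) (k : Fin n) : ∀ i, 𝒳r i :=
  fun i => c.relay i k (fun j => (ω ⟨j, j.2.trans k.2⟩).2 i)

/-- The probability that the outputs at the destination and at the relays during the block are `ω`
if message `w` is sent over the memoryless channel. -/
def RelayChannel.blockProb (ch : RelayChannel 𝒳 𝒴 𝒳r 𝒴r) {M n : ℕ}
    (c : RelayCode 𝒳 𝒴 𝒳r 𝒴r M n) (w : Fin M) (ω : Fin n → 𝒴 × (∀ i, 𝒴r i)) : ℝ :=
  ∏ k, ch.prob (c.enc w k) (c.relayInput ω k) (ω k)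

/-- The average probability of error, for a uniformly distributed message. -/
def RelayChannel.errorProb (ch : RelayChannel 𝒳 𝒴 𝒳r 𝒴r) {M n : ℕ}
    (c : RelayCode 𝒳 𝒴 𝒳r 𝒴r M n) : ℝ :=
  (∑ w, ∑ ω : Fin n → 𝒴 × (∀ i, 𝒴r i),
    if c.dec (fun k => (ω k).1) ≠ w then ch.blockProb c w ω else 0) / M

/-- The rate `R` (in bits per channel use) is achievable: there is a sequence of codes with
`⌈2 ^ (n R)⌉` messages and length `n` whose average probability of error tends to `0`. -/
def RelayChannel.Achievable (ch : RelayChannel 𝒳 𝒴 𝒳r 𝒴r) (R : ℝ) : Prop :=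
  ∃ c : ∀ n : ℕ, RelayCode 𝒳 𝒴 𝒳r 𝒴r ⌈(2 : ℝ) ^ ((n : ℝ) * R)⌉₊ n,
    Tendsto (fun n => ch.errorProb (c n)) atTop (𝓝 0)

end Channel

/-! ### The single-letter distribution and the rate -/

/-- A joint outcome `(x, (x₁, …, x_N), y, (y₁, …, y_N))`. -/
abbrev Outcome {N : ℕ} (𝒳 𝒴 : Type*) (𝒳r 𝒴r : Fin N → Type*) : Type _ :=
  𝒳 × (∀ i, 𝒳r i) × 𝒴 × (∀ i, 𝒴r i)

section Variables

variable {N : ℕ} {𝒳 𝒴 : Type*} {𝒳r 𝒴r : Fin N → Type*}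

/-- The source input `X`. -/
def srcIn (ω : Outcome 𝒳 𝒴 𝒳r 𝒴r) : 𝒳 := ω.1

/-- The vector `(X₁, …, X_N)` of all relay inputs. -/
def relayIns (ω : Outcome 𝒳 𝒴 𝒳r 𝒴r) : ∀ i, 𝒳r i := ω.2.1

/-- The input `X_i` of relay `i`. -/
def relayIn (i : Fin N) (ω : Outcome 𝒳 𝒴 𝒳r 𝒴r) : 𝒳r i := ω.2.1 i

/-- The vector `(X_i)` with `i` in `S`. -/
def relayInsOn (S : Finset (Fin N)) (ω : Outcome 𝒳 𝒴 𝒳r 𝒴r) : ∀ i : S, 𝒳r i :=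
  fun i => ω.2.1 i

/-- The output `Y` at the destination. -/
def dstOut (ω : Outcome 𝒳 𝒴 𝒳r 𝒴r) : 𝒴 := ω.2.2.1

/-- The output `Y_i` at relay `i`. -/
def relayOut (i : Fin N) (ω : Outcome 𝒳 𝒴 𝒳r 𝒴r) : 𝒴r i := ω.2.2.2 i

/-- The vector `(Y_i)` with `i` in `S`. -/
def relayOutsOn (S : Finset (Fin N)) (ω : Outcome 𝒳 𝒴 𝒳r 𝒴r) : ∀ i : S, 𝒴r i :=
  fun i => ω.2.2.2 i

/-- The pair of the vector `(X₁, …, X_N)` and `Y`. -/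
def insAndOut (ω : Outcome 𝒳 𝒴 𝒳r 𝒴r) : (∀ i, 𝒳r i) × 𝒴 := (relayIns ω, dstOut ω)

end Variables

open Classical in
/-- The relays that come before relay `i` in the order `prec`. -/
def before {N : ℕ} (prec : Fin N → Fin N → Prop) (i : Fin N) : Finset (Fin N) :=
  {j | prec j i}

/-- The probability that exactly the relays in `S` are unerased among those in `T`, where relay `i`
is unerased with probability `q i`, independently. -/
def subsetProb {N : ℕ} (q : Fin N → ℝ) (T S : Finset (Fin N)) : ℝ :=
  (∏ i ∈ S, q i) * ∏ i ∈ T \ S, (1 - q i)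

section Rate

variable {N : ℕ} {𝒳 𝒴 : Type*} {𝒳r 𝒴r : Fin N → Type*}
  [Fintype 𝒳] [Fintype 𝒴] [∀ i, Fintype (𝒳r i)] [∀ i, Fintype (𝒴r i)]

/-- The joint distribution `p(x) p(x₁) ⋯ p(x_N) p(y, y₁, …, y_N | x, x₁, …, x_N)`. -/
def RelayChannel.joint (ch : RelayChannel 𝒳 𝒴 𝒳r 𝒴r) (p : 𝒳 → ℝ) (pr : ∀ i, 𝒳r i → ℝ)
    (ω : Outcome 𝒳 𝒴 𝒳r 𝒴r) : ℝ :=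
  p (srcIn ω) * (∏ i, pr i (relayIn i ω)) * ch.prob ω.1 ω.2.1 ω.2.2

/-- The numerator `I(X_i; Y | Z_i)`, where `Z_i` consists of the `X_j` with `j` in `Z`. -/
def qNum (P : Outcome 𝒳 𝒴 𝒳r 𝒴r → ℝ) (Z : Finset (Fin N)) (i : Fin N) : ℝ :=
  condMutualInfo P (relayIn i) dstOut (relayInsOn Z)

/-- The denominator `H(Y_i | X₁, …, X_N, Y) - ∑ P_T(S) I(Y_i; Y_S | X₁, …, X_N, Y)`, where `S` runs
over the nonempty subsets of `T`. -/
def qDen (P : Outcome 𝒳 𝒴 𝒳r 𝒴r → ℝ) (T : Finset (Fin N)) (q : Fin N → ℝ) (i : Fin N) : ℝ :=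
  condEntropy P (relayOut i) insAndOut -
    ∑ S ∈ T.powerset.erase ∅,
      subsetProb q T S * condMutualInfo P (relayOut i) (relayOutsOn S) insAndOut

/-- The clipped ratio `min (a / b) 1`, with value `1` if `b = 0`. -/
def clippedRatio (a b : ℝ) : ℝ :=
  if b = 0 then 1 else min (a / b) 1

open Classical in
/-- The parameters `q_i`, by recursion along the decoding order `precY`; only the `q_j` with
`precY j i` matter for `q_i`, see `timeShare_eq`. -/
def timeShare (P : Outcome 𝒳 𝒴 𝒳r 𝒴r → ℝ) (precX precY : Fin N → Fin N → Prop)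
    [IsStrictOrder (Fin N) precY] : Fin N → ℝ :=
  (Finite.wellFounded_of_trans_of_irrefl precY).fix fun i q =>
    clippedRatio (qNum P (before precX i) i)
      (qDen P (before precY i) (fun j => if h : precY j i then q j h else 0) i)

/-- The explicit formula for the `q_i`. -/
theorem timeShare_eq (P : Outcome 𝒳 𝒴 𝒳r 𝒴r → ℝ) (precX precY : Fin N → Fin N → Prop)
    [IsStrictOrder (Fin N) precY] (i : Fin N) :
    timeShare P precX precY i =
      clippedRatio (qNum P (before precX i) i)
        (qDen P (before precY i) (timeShare P precX precY) i) := by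
  have key : ∀ q q' : Fin N → ℝ, (∀ j ∈ before precY i, q j = q' j) →
      qDen P (before precY i) q i = qDen P (before precY i) q' i := by
    intro q q' h
    unfold qDen subsetProb
    congr 1
    refine Finset.sum_congr rfl fun S hS => ?_
    have hS' : S ⊆ before precY i := Finset.mem_powerset.1 (Finset.mem_of_mem_erase hS)
    congr 2
    · exact Finset.prod_congr rfl fun j hj => h j (hS' hj)
    · exact Finset.prod_congr rfl fun j hj => by rw [h j (Finset.mem_sdiff.1 hj).1]
  conv_lhs => rw [timeShare, WellFounded.fix_eq]
  congr 1
  refine key _ _ fun j hj => ?_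
  have hj' : precY j i := by simpa [before] using hj
  rw [dif_pos hj']
  rfl

/-- The rate `I(X; Y | X₁, …, X_N) + ∑ P(S) I(X; Y_S | X₁, …, X_N, Y)`, where `S` runs over the
nonempty sets of relays. -/
def eafRate (P : Outcome 𝒳 𝒴 𝒳r 𝒴r → ℝ) (q : Fin N → ℝ) : ℝ :=
  condMutualInfo P srcIn dstOut relayIns +
    ∑ S ∈ (univ : Finset (Fin N)).powerset.erase ∅,
      subsetProb q univ S * condMutualInfo P srcIn (relayOutsOn S) insAndOut

end Rate

end MultiRelay

end

/-!
The proof is a block Markov scheme with random binning, analysed with threshold tests in place of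
typical sets, so that every estimate is about a finite sum of products.

*One block.* The code for a block (`BlockCode`) consists of a public mask `θ k` (a set of relays)
for each time `k`, words for the messages of the source and for the indices of the relays, and bins
for the possible output sequences of the relays. Relay `i` describes its outputs at the times `k`
with `i ∈ θ k` only, the others being replaced by a fixed letter. The masks realise the time sharing
of the rate formula: if relay `i` is in the mask with probability `q i`, independently, then the
mask has the law `subsetProb q univ`, and all weights `P(θ)`, `P_T(S)` of the formula arise as its
marginals (`sum_subsetProb_mem_inter`). The bin of the masked outputs is the index that relay `i`
transmits in the next block.

*Decoding.* A candidate passes if the product over the block of its likelihood ratios exceeds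
`2 ^ (n τ)`. The destination decodes the words of the relays along `≺_X`; they reveal the bins of the
masked outputs of the preceding block, which are then decoded along `≺_Y`; finally it decodes the
message of the preceding block. A block is good (`Tests.Good`) if all true candidates pass and no
false one does, and in good blocks the successive decoding is correct (`Tests.Good.relay_eq`,
`Tests.Good.masked_eq`, `Tests.Good.source_eq`). For a random code, true candidates pass by
Chernoff's bound if `τ` is below the expected logarithm of the ratio (`exists_sum_prod_mul_le_pow`),
and a false word passes with probability at most `2 ^ (-n τ)`, since it may be resampled
independently of everything else (`sum_prod_mul_threshold_le`). For the masked outputs, the same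
bound counts the sequences that pass, and binning removes all but a fraction of the false ones
(`codeExpect_index_false_le`). The expected logarithms are `I(X_i; Y | Z_i)` for the relay words,
`-q_i` times the denominator of `q_i` for the masked outputs, and the rate of the theorem for the
source (`likelihoodTests_reliable`). Hence a relay rate between `q_i` times the denominator and the
numerator makes the error probability of a block tend to `0` (`exists_tendsto_codeExpect_le`).

*Many blocks.* The codes of the blocks are chosen one after the other. Once the first `b` blocks are
fixed, they determine a distribution of the relay indices, and some code for the next block has at
most the average error under this distribution (`exists_blockCode_le`); for this reason neither
independence of the blocks nor uniformity of the indices is needed (`TransmitsDigits.append`). With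
`B + 1` blocks for `B` digits of the message the loss of rate is a factor `B / (B + 1)`
(`eventually_exists_errorProb_le`).

*Strict inequalities.* The numbers `q_i` of the theorem satisfy `q_i · denominator ≤ numerator`,
often with equality. Relays whose denominator vanishes have outputs that the destination knows
anyway, so that they may be dropped from the masks, and the other `q_i` may be changed slightly, by
recursion along `≺_Y`, so that the inequalities become strict, with an arbitrarily small change of
the rate (`exists_strictly_feasible`).
-/

namespace MultiRelay

/-! ### Indicators -/

open Classical in
/-- The number `1` if `p` holds and `0` otherwise. -/
noncomputable def ind (p : Prop) : ℝ := if p then 1 else 0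

theorem ind_of_true {p : Prop} (h : p) : ind p = 1 := if_pos h

theorem ind_of_false {p : Prop} (h : ¬p) : ind p = 0 := if_neg h

theorem ind_nonneg (p : Prop) : 0 ≤ ind p := by
  rw [ind]; split_ifs <;> norm_num

theorem ind_mono {p q : Prop} (h : p → q) : ind p ≤ ind q := by
  by_cases hp : p
  · rw [ind_of_true hp, ind_of_true (h hp)]
  · rw [ind_of_false hp]; exact ind_nonneg q

theorem ind_or_le {p q : Prop} {a b : ℝ} (hp : ind p ≤ a) (hq : ind q ≤ b) :
    ind (p ∨ q) ≤ a + b := by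
  have hp0 := ind_nonneg p
  have hq0 := ind_nonneg q
  by_cases h : p
  · rw [ind_of_true h] at hp; rw [ind_of_true (Or.inl h)]; linarith
  · refine (ind_mono fun h' => h'.resolve_left h).trans ?_; linarith

theorem ind_exists_le {ι : Type*} [Fintype ι] {Q : ι → Prop} {a : ι → ℝ}
    (h : ∀ i, ind (Q i) ≤ a i) : ind (∃ i, Q i) ≤ ∑ i, a i := by
  have h0 : ∀ i, 0 ≤ a i := fun i => (ind_nonneg _).trans (h i)
  by_cases hQ : ∃ i, Q i
  · obtain ⟨i, hi⟩ := hQ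
    refine le_trans ?_ (Finset.single_le_sum (fun i _ => h0 i) (mem_univ i))
    exact (ind_mono fun _ => hi).trans (h i)
  · rw [ind_of_false hQ]
    exact Finset.sum_nonneg fun i _ => h0 i

theorem ind_le {p : Prop} {a : ℝ} (ha : 0 ≤ a) (h : p → 1 ≤ a) : ind p ≤ a := by
  rw [ind]; split_ifs with hp
  exacts [h hp, ha]

/-! ### Product weights on finite function spaces -/

section ProductWeights

theorem prod_update_mul {A : Type*} [Fintype A] [DecidableEq A] {B : A → Type*}
    (q : ∀ a, B a → ℝ) (f : ∀ a, B a) (a₀ : A) (u : B a₀) :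
    (∏ a, q a (Function.update f a₀ u a)) * q a₀ (f a₀) = (∏ a, q a (f a)) * q a₀ u := by
  rw [← Finset.mul_prod_erase univ _ (mem_univ a₀), ← Finset.mul_prod_erase univ _ (mem_univ a₀)]
  have : ∏ a ∈ univ.erase a₀, q a (Function.update f a₀ u a) = ∏ a ∈ univ.erase a₀, q a (f a) :=
    Finset.prod_congr rfl fun a ha => by rw [Function.update_of_ne (Finset.ne_of_mem_erase ha)]
  rw [this, Function.update_self]
  ring

variable {A : Type*} [Fintype A] [DecidableEq A] {B : A → Type*} [∀ a, Fintype (B a)]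

theorem sum_prod_apply (q : ∀ a, B a → ℝ) :
    ∑ f : ∀ a, B a, ∏ a, q a (f a) = ∏ a, ∑ b, q a b := by
  rw [Finset.prod_univ_sum, Fintype.piFinset_univ]

theorem sum_prod_apply_eq_one {q : ∀ a, B a → ℝ} (hq : ∀ a, ∑ b, q a b = 1) :
    ∑ f : ∀ a, B a, ∏ a, q a (f a) = 1 := by
  simp [sum_prod_apply, hq]

/-- Under a product distribution, the coordinate `a₀` may be replaced by an independent copy in
an expression that depends on it only through its second argument. -/
theorem sum_prod_mul_resample {q : ∀ a, B a → ℝ} (a₀ : A) (hq : ∑ b, q a₀ b = 1)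
    (g : (∀ a, B a) → B a₀ → ℝ)
    (hg : ∀ f u v, g (Function.update f a₀ u) v = g f v) :
    ∑ f : ∀ a, B a, (∏ a, q a (f a)) * g f (f a₀) =
      ∑ f : ∀ a, B a, (∏ a, q a (f a)) * ∑ u, q a₀ u * g f u := by
  have h1 : ∀ f : ∀ a, B a, (∏ a, q a (f a)) * g f (f a₀) =
      ∑ u, (∏ a, q a (f a)) * q a₀ u * g f (f a₀) := fun f => by
    simp_rw [mul_assoc, ← Finset.mul_sum, ← Finset.sum_mul, hq, one_mul]
  simp_rw [h1, Finset.mul_sum, ← mul_assoc, ← Fintype.sum_prod_type']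
  -- exchanging the coordinate with the independent copy is an involution
  refine Finset.sum_nbij' (fun x => (Function.update x.1 a₀ x.2, x.1 a₀))
    (fun x => (Function.update x.1 a₀ x.2, x.1 a₀)) (by simp) (by simp) (by simp) (by simp) ?_
  rintro ⟨f, u⟩ -
  simp only
  rw [hg, prod_update_mul]

/-- The marginal of a product distribution on the coordinates `e j`. -/
theorem sum_prod_mul_comp {J : Type*} [Fintype J] [DecidableEq J] {q : ∀ a, B a → ℝ}
    (hq : ∀ a, ∑ b, q a b = 1) (e : J → A) (he : Function.Injective e)
    (g : (∀ j, B (e j)) → ℝ) :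
    ∑ f : ∀ a, B a, (∏ a, q a (f a)) * g (fun j => f (e j)) =
      ∑ h : ∀ j, B (e j), (∏ j, q (e j) (h j)) * g h := by
  classical
  -- `g` is expanded in the indicators of its arguments `h`, and these are products over `A`
  have h1 : ∀ f : ∀ a, B a, (∏ a, q a (f a)) * g (fun j => f (e j)) =
      ∑ h : ∀ j, B (e j),
        (∏ a, q a (f a) * if ∀ j (hj : e j = a), f a = hj ▸ h j then 1 else 0) * g h := by
    intro f
    have h2 : ∀ h : ∀ j, B (e j),
        (∏ a, if ∀ j (hj : e j = a), f a = hj ▸ h j then (1 : ℝ) else 0) =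
          if (fun j => f (e j)) = h then 1 else 0 := by
      intro h
      split_ifs with hh
      · subst hh
        refine Finset.prod_eq_one fun a _ => if_pos ?_
        rintro j rfl
        rfl
      · obtain ⟨j, hj⟩ := Function.ne_iff.1 hh
        exact Finset.prod_eq_zero (mem_univ (e j)) (if_neg fun h' => hj (h' j rfl))
    simp_rw [Finset.prod_mul_distrib, h2]
    simp
  simp_rw [h1]
  rw [Finset.sum_comm]
  refine Finset.sum_congr rfl fun h _ => ?_
  rw [← Finset.sum_mul,
    sum_prod_apply (fun a b => q a b * if ∀ j (hj : e j = a), b = hj ▸ h j then 1 else 0)]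
  congr 1
  rw [← Finset.prod_subset (Finset.subset_univ (univ.image e))]
  · rw [Finset.prod_image fun _ _ _ _ h => he h]
    refine Finset.prod_congr rfl fun j _ => ?_
    rw [Finset.sum_eq_single (h j)]
    · rw [if_pos, mul_one]
      intro j' hj'
      obtain rfl := he hj'
      rfl
    · intro b _ hb
      rw [if_neg, mul_zero]
      exact fun h' => hb (h' j rfl)
    · simp
  · intro a _ ha
    refine (Finset.sum_congr rfl fun b _ => ?_).trans (hq a)
    rw [if_pos, mul_one]
    rintro j rfl
    exact absurd (Finset.mem_image_of_mem e (mem_univ j)) ha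

end ProductWeights

/-! ### Threshold tests -/

section Threshold

variable {U : Type*} [Fintype U]

/-- Few candidates pass a threshold test: if `r` is a subdensity with respect to `q` in each
coordinate, then the product weight of the words whose score exceeds `t` is at most `1 / t`. -/
theorem sum_prod_mul_threshold_le {n : ℕ} (q : U → ℝ) (hq : ∀ u, 0 ≤ q u)
    (r : Fin n → U → ℝ) (hr : ∀ k u, 0 ≤ r k u) (hqr : ∀ k, ∑ u, q u * r k u ≤ 1)
    {t : ℝ} (ht : 0 < t) :
    ∑ u : Fin n → U, (∏ k, q (u k)) * ind (t < ∏ k, r k (u k)) ≤ t⁻¹ := by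
  have h1 : ∀ u : Fin n → U, (∏ k, q (u k)) * ind (t < ∏ k, r k (u k)) ≤
      t⁻¹ * ∏ k, q (u k) * r k (u k) := by
    intro u
    have h0 : 0 ≤ ∏ k, q (u k) := Finset.prod_nonneg fun k _ => hq _
    have h0' : 0 ≤ ∏ k, r k (u k) := Finset.prod_nonneg fun k _ => hr _ _
    rw [Finset.prod_mul_distrib, mul_left_comm]
    refine mul_le_mul_of_nonneg_left ?_ h0
    refine ind_le (by positivity) fun h => ?_
    rw [← div_eq_inv_mul, one_le_div ht]
    exact h.le
  calc _ ≤ ∑ u : Fin n → U, t⁻¹ * ∏ k, q (u k) * r k (u k) := Finset.sum_le_sum fun u _ => h1 u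
    _ = t⁻¹ * ∏ k, ∑ u, q u * r k u := by
        rw [← Finset.mul_sum, sum_prod_apply (fun k u => q u * r k u)]
    _ ≤ t⁻¹ * 1 := by
        refine mul_le_mul_of_nonneg_left ?_ (inv_nonneg.2 ht.le)
        exact Finset.prod_le_one
          (fun k _ => Finset.sum_nonneg fun u _ => mul_nonneg (hq u) (hr k u)) fun k _ => hqr k
    _ = t⁻¹ := mul_one _

/-- The true word passes a threshold test, up to an exponentially small probability, if the
expected logarithm of the score exceeds the exponent of the threshold. This is Chernoff's bound. -/
theorem exists_sum_prod_mul_le_pow {Ω : Type*} [Fintype Ω] (P : Ω → ℝ) (hP : ∀ ω, 0 ≤ P ω)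
    (hP1 : ∑ ω, P ω = 1) (ρ : Ω → ℝ) (hρ : ∀ ω, P ω ≠ 0 → 0 < ρ ω) {τ : ℝ}
    (hτ : τ < ∑ ω, P ω * Real.logb 2 (ρ ω)) :
    ∃ a : ℝ, 0 ≤ a ∧ a < 1 ∧ ∀ n : ℕ, ∑ ω : Fin n → Ω, (∏ k, P (ω k)) *
      ind (∏ k, ρ (ω k) ≤ (2 : ℝ) ^ (n * τ)) ≤ a ^ n := by
  have h2 : (0 : ℝ) < Real.log 2 := Real.log_pos (by norm_num)
  -- the moment generating function of the deficit `τ - log₂ ρ`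
  set d : Ω → ℝ := fun ω => Real.log 2 * τ - Real.log (ρ ω) with hd
  set φ : ℝ → ℝ := fun s => ∑ ω, P ω * Real.exp (s * d ω) with hφ
  have hφ0 : φ 0 = 1 := by simp [hφ, hP1]
  have hderiv : HasDerivAt φ (∑ ω, P ω * d ω) 0 := by
    refine HasDerivAt.fun_sum fun ω _ => ?_
    have := (((hasDerivAt_id (0 : ℝ)).mul_const (d ω)).exp).const_mul (P ω)
    simpa using this
  have hneg : ∑ ω, P ω * d ω < 0 := by
    have e1 : ∑ ω, P ω * d ω = Real.log 2 * (τ - ∑ ω, P ω * Real.logb 2 (ρ ω)) := by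
      have : ∀ ω, P ω * d ω = Real.log 2 * τ * P ω - Real.log 2 * (P ω * Real.logb 2 (ρ ω)) := by
        intro ω
        simp only [hd, Real.logb]
        field_simp
      simp_rw [this, Finset.sum_sub_distrib, ← Finset.mul_sum, hP1]
      ring
    rw [e1]
    exact mul_neg_of_pos_of_neg h2 (by linarith)
  obtain ⟨s, hs0, hs1⟩ : ∃ s : ℝ, 0 < s ∧ φ s < 1 := by
    have hlt : ∀ᶠ s in 𝓝[>] (0 : ℝ), slope φ 0 s < 0 :=
      (hderiv.tendsto_slope.mono_left
        (nhdsWithin_mono 0 fun s hs => ne_of_gt hs)).eventually_lt_const hneg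
    obtain ⟨s, hs, hs0⟩ := (hlt.and self_mem_nhdsWithin).exists
    have hs0 : 0 < s := hs0
    refine ⟨s, hs0, ?_⟩
    rw [slope_def_field, hφ0, sub_zero, div_neg_iff] at hs
    rcases hs with h | h
    · linarith [h.2]
    · linarith [h.1]
  refine ⟨φ s, Finset.sum_nonneg fun ω _ => mul_nonneg (hP ω) (Real.exp_pos _).le, hs1,
    fun n => ?_⟩
  have h3 : φ s ^ n = ∑ ω : Fin n → Ω, ∏ k, P (ω k) * Real.exp (s * d (ω k)) := by
    rw [sum_prod_apply (fun _ ω => P ω * Real.exp (s * d ω))]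
    simp [hφ]
  rw [h3]
  refine Finset.sum_le_sum fun ω _ => ?_
  rw [Finset.prod_mul_distrib]
  by_cases hsupp : ∀ k, P (ω k) ≠ 0
  · refine mul_le_mul_of_nonneg_left ?_ (Finset.prod_nonneg fun k _ => hP _)
    refine ind_le (Finset.prod_nonneg fun k _ => (Real.exp_pos _).le) fun h => ?_
    rw [← Real.exp_sum, ← Finset.mul_sum]
    refine Real.one_le_exp (mul_nonneg hs0.le ?_)
    have hpos : 0 < ∏ k, ρ (ω k) := Finset.prod_pos fun k _ => hρ _ (hsupp k)
    have h4 := Real.log_le_log hpos h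
    rw [Real.log_prod fun k _ => (hρ _ (hsupp k)).ne', Real.log_rpow (by norm_num)] at h4
    simp only [hd, Finset.sum_sub_distrib, Finset.sum_const, card_univ, Fintype.card_fin,
      nsmul_eq_mul]
    linarith
  · push Not at hsupp
    obtain ⟨k, hk⟩ := hsupp
    rw [Finset.prod_eq_zero (mem_univ k) hk]
    simp

end Threshold

/-! ### Laws and conditional entropies -/

section Laws

variable {Ω α β γ : Type*} [Fintype Ω] {P : Ω → ℝ}

theorem law_nonneg (hP : ∀ ω, 0 ≤ P ω) (U : Ω → α) (a : α) : 0 ≤ law P U a :=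
  Finset.sum_nonneg fun ω _ => by split_ifs <;> simp [hP]

theorem le_law (hP : ∀ ω, 0 ≤ P ω) (U : Ω → α) (ω : Ω) : P ω ≤ law P U (U ω) := by
  classical
  have := Finset.single_le_sum (f := fun ω' => if U ω' = U ω then P ω' else 0)
    (fun ω' _ => by split_ifs <;> simp [hP]) (mem_univ ω)
  simpa [law] using this

theorem law_pos (hP : ∀ ω, 0 ≤ P ω) (U : Ω → α) {ω : Ω} (hω : P ω ≠ 0) : 0 < law P U (U ω) :=
  ((hP ω).lt_of_ne' hω).trans_le (le_law hP U ω)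

/-- The probability of an atom only depends on the partition that the variable induces on the
support of the distribution. -/
theorem law_apply_congr {U : Ω → α} {V : Ω → β} {ω : Ω}
    (h : ∀ ω', P ω' ≠ 0 → (U ω' = U ω ↔ V ω' = V ω)) :
    law P U (U ω) = law P V (V ω) := by
  classical
  refine Finset.sum_congr rfl fun ω' _ => ?_
  by_cases h0 : P ω' = 0
  · simp [h0]
  · simp [h ω' h0]

theorem sum_law_mul [Fintype α] (U : Ω → α) (f : α → ℝ) :
    ∑ a, law P U a * f a = ∑ ω, P ω * f (U ω) := by
  classical
  simp_rw [law, Finset.sum_mul]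
  rw [Finset.sum_comm]
  refine Finset.sum_congr rfl fun ω _ => ?_
  simp

theorem sum_law_pair [Fintype α] (U : Ω → α) (V : Ω → β) (v : β) :
    ∑ u, law P (fun ω => (U ω, V ω)) (u, v) = law P V v := by
  classical
  simp_rw [law]
  rw [Finset.sum_comm]
  refine Finset.sum_congr rfl fun ω _ => ?_
  simp only [Prod.mk.injEq]
  by_cases hv : V ω = v <;> simp [hv]

theorem law_pair_le (hP : ∀ ω, 0 ≤ P ω) (U : Ω → α) (V : Ω → β) (u : α) (v : β) :
    law P (fun ω => (U ω, V ω)) (u, v) ≤ law P V v := by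
  classical
  refine Finset.sum_le_sum fun ω _ => ?_
  by_cases hv : V ω = v
  · by_cases hu : U ω = u <;> simp [hu, hv, hP]
  · simp [hv]

/-- The conditional probability `P(U = u | V = v)`, with value `0` if `P(V = v) = 0`. -/
noncomputable def condProb (P : Ω → ℝ) (U : Ω → α) (V : Ω → β) (u : α) (v : β) : ℝ :=
  law P (fun ω => (U ω, V ω)) (u, v) / law P V v

theorem condProb_nonneg (hP : ∀ ω, 0 ≤ P ω) (U : Ω → α) (V : Ω → β) (u : α) (v : β) :
    0 ≤ condProb P U V u v :=
  div_nonneg (law_nonneg hP _ _) (law_nonneg hP _ _)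

theorem condProb_le_one (hP : ∀ ω, 0 ≤ P ω) (U : Ω → α) (V : Ω → β) (u : α) (v : β) :
    condProb P U V u v ≤ 1 :=
  div_le_one_of_le₀ (law_pair_le hP U V u v) (law_nonneg hP _ _)

theorem condProb_pos (hP : ∀ ω, 0 ≤ P ω) (U : Ω → α) (V : Ω → β) {ω : Ω} (hω : P ω ≠ 0) :
    0 < condProb P U V (U ω) (V ω) :=
  div_pos (law_pos hP (fun ω => (U ω, V ω)) hω) (law_pos hP V hω)

theorem sum_condProb_le_one [Fintype α] (U : Ω → α) (V : Ω → β) (v : β) :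
    ∑ u, condProb P U V u v ≤ 1 := by
  simp_rw [condProb, ← Finset.sum_div, sum_law_pair]
  exact div_self_le_one _

variable [Fintype α] [Fintype β] [Fintype γ]

theorem condEntropy_eq_neg_sum (P : Ω → ℝ) (U : Ω → α) (V : Ω → β) :
    condEntropy P U V = -∑ ω, P ω * Real.logb 2 (condProb P U V (U ω) (V ω)) := by
  rw [condEntropy, ← sum_law_mul (fun ω => (U ω, V ω))
    (fun x => Real.logb 2 (condProb P U V x.1 x.2)), Fintype.sum_prod_type]
  rfl

/-- The conditional entropy only depends on the partitions that the two variables induce on the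
support of the distribution. -/
theorem condEntropy_congr {α' β' : Type*} [Fintype α'] [Fintype β'] {U : Ω → α} {V : Ω → β}
    {U' : Ω → α'} {V' : Ω → β'}
    (hV : ∀ ω ω', P ω ≠ 0 → P ω' ≠ 0 → (V ω' = V ω ↔ V' ω' = V' ω))
    (hU : ∀ ω ω', P ω ≠ 0 → P ω' ≠ 0 → V ω' = V ω → (U ω' = U ω ↔ U' ω' = U' ω)) :
    condEntropy P U V = condEntropy P U' V' := by
  rw [condEntropy_eq_neg_sum, condEntropy_eq_neg_sum]
  congr 1
  refine Finset.sum_congr rfl fun ω _ => ?_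
  by_cases h0 : P ω = 0
  · simp [h0]
  rw [condProb, condProb, law_apply_congr (U := V) (V := V') fun ω' h' => hV ω ω' h0 h',
    law_apply_congr (U := fun ω => (U ω, V ω)) (V := fun ω => (U' ω, V' ω)) (ω := ω)
      fun ω' h' => ?_]
  simp only [Prod.mk.injEq]
  constructor
  · rintro ⟨h1, h2⟩
    exact ⟨(hU ω ω' h0 h' h2).1 h1, (hV ω ω' h0 h').1 h2⟩
  · rintro ⟨h1, h2⟩
    have h2' := (hV ω ω' h0 h').2 h2
    exact ⟨(hU ω ω' h0 h' h2').2 h1, h2'⟩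

theorem condEntropy_nonneg (hP : ∀ ω, 0 ≤ P ω) (U : Ω → α) (V : Ω → β) :
    0 ≤ condEntropy P U V := by
  rw [condEntropy_eq_neg_sum, neg_nonneg]
  exact Finset.sum_nonpos fun ω _ => mul_nonpos_of_nonneg_of_nonpos (hP ω)
    (Real.logb_nonpos (by norm_num) (condProb_nonneg hP _ _ _ _) (condProb_le_one hP _ _ _ _))

/-- If `H(U | V) = 0`, then `U` is a function of `V` on the support of the distribution. -/
theorem eq_of_condEntropy_eq_zero (hP : ∀ ω, 0 ≤ P ω) {U : Ω → α} {V : Ω → β}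
    (h : condEntropy P U V = 0) {ω ω' : Ω} (hω : P ω ≠ 0) (hω' : P ω' ≠ 0) (hV : V ω' = V ω) :
    U ω' = U ω := by
  classical
  rw [condEntropy_eq_neg_sum, neg_eq_zero, Finset.sum_eq_zero_iff_of_nonpos] at h
  swap
  · exact fun ω _ => mul_nonpos_of_nonneg_of_nonpos (hP ω)
      (Real.logb_nonpos (by norm_num) (condProb_nonneg hP _ _ _ _) (condProb_le_one hP _ _ _ _))
  have h1 : Real.logb 2 (condProb P U V (U ω) (V ω)) = 0 :=
    (mul_eq_zero.1 (h ω (mem_univ ω))).resolve_left hω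
  have hpos := condProb_pos hP U V hω
  have h2 : condProb P U V (U ω) (V ω) = 1 := by
    rcases Real.logb_eq_zero.1 h1 with h | h | h | h | h | h
    · norm_num at h
    · norm_num at h
    · norm_num at h
    · exact absurd h hpos.ne'
    · exact h
    · linarith
  rw [condProb, div_eq_one_iff_eq (law_pos hP V hω).ne'] at h2
  by_contra hne
  have h3 : law P (fun ω => (U ω, V ω)) (U ω', V ω) + law P (fun ω => (U ω, V ω)) (U ω, V ω) ≤
      law P V (V ω) := by
    rw [← sum_law_pair U V (V ω),
      ← Finset.sum_pair (f := fun u => law P (fun ω => (U ω, V ω)) (u, V ω)) hne]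
    exact Finset.sum_le_sum_of_subset_of_nonneg (Finset.subset_univ _)
      fun _ _ _ => law_nonneg hP _ _
  have h4 := law_pos hP (fun ω => (U ω, V ω)) hω'
  rw [hV] at h4
  linarith

/-- If `H(W | V) = 0`, then `W` may be added to the condition `V`, or to a finer one. -/
theorem condEntropy_pair_eq_of_condEntropy_eq_zero (hP : ∀ ω, 0 ≤ P ω) {δ : Type*} [Fintype δ]
    {U : Ω → α} {V : Ω → β} {W : Ω → γ} {V' : Ω → δ} (h : condEntropy P W V = 0)
    (hV : ∀ ω ω', V' ω' = V' ω → V ω' = V ω) :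
    condEntropy P U (fun ω => (W ω, V' ω)) = condEntropy P U V' := by
  refine condEntropy_congr (fun ω ω' hω hω' => ?_) fun _ _ _ _ _ => Iff.rfl
  simp only [Prod.mk.injEq, and_iff_right_iff_imp]
  exact fun h' => eq_of_condEntropy_eq_zero hP h hω hω' (hV _ _ h')

/-- The expected logarithm of the likelihood ratio `P(U | V) / q(U)` is nonnegative if `q` is a
probability vector. -/
theorem sum_mul_logb_condProb_div_nonneg (hP : ∀ ω, 0 ≤ P ω) (hP1 : ∑ ω, P ω = 1)
    (U : Ω → α) (V : Ω → β) (q : α → ℝ) (hq : ∀ u, 0 ≤ q u) (hq1 : ∑ u, q u = 1)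
    (hqU : ∀ ω, P ω ≠ 0 → q (U ω) ≠ 0) :
    0 ≤ ∑ ω, P ω * Real.logb 2 (condProb P U V (U ω) (V ω) / q (U ω)) := by
  classical
  have h2 : (0 : ℝ) < Real.log 2 := Real.log_pos (by norm_num)
  -- the sum of `P(ω) q(U) / P(U | V)` is a sum of `q(u) P(v)` over the support
  have h1 : ∑ ω, P ω * (q (U ω) / condProb P U V (U ω) (V ω)) ≤ 1 := by
    rw [← sum_law_mul (fun ω => (U ω, V ω)) (fun x => q x.1 / condProb P U V x.1 x.2),
      Fintype.sum_prod_type]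
    calc _ ≤ ∑ u, ∑ v, q u * law P V v := by
          refine Finset.sum_le_sum fun u _ => Finset.sum_le_sum fun v _ => ?_
          simp only [condProb, div_div_eq_mul_div]
          by_cases h0 : law P (fun ω => (U ω, V ω)) (u, v) = 0
          · simp only [h0, zero_mul]
            exact mul_nonneg (hq u) (law_nonneg hP _ _)
          · rw [mul_div_cancel₀ _ h0]
      _ = 1 := by
          simp_rw [← Finset.mul_sum, ← Finset.sum_mul, hq1, one_mul]
          simpa [hP1] using sum_law_mul (P := P) V (fun _ => 1)
  have h3 : ∀ ω, P ω - P ω * (q (U ω) / condProb P U V (U ω) (V ω)) ≤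
      Real.log 2 * (P ω * Real.logb 2 (condProb P U V (U ω) (V ω) / q (U ω))) := by
    intro ω
    by_cases h0 : P ω = 0
    · simp [h0]
    have hc := condProb_pos hP U V h0
    have hq0 := (hq (U ω)).lt_of_ne' (hqU ω h0)
    have h4 := Real.log_le_sub_one_of_pos (div_pos hq0 hc)
    have h5 : Real.log (condProb P U V (U ω) (V ω) / q (U ω)) =
        -Real.log (q (U ω) / condProb P U V (U ω) (V ω)) := by
      rw [← Real.log_inv, inv_div]
    rw [Real.logb, h5]
    have h6 := mul_le_mul_of_nonneg_left h4 (hP ω)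
    field_simp at h6 ⊢
    linarith
  have h4 := Finset.sum_le_sum fun ω (_ : ω ∈ univ) => h3 ω
  rw [Finset.sum_sub_distrib, hP1, ← Finset.mul_sum] at h4
  exact nonneg_of_mul_nonneg_right (by linarith) h2

end Laws

/-! ### Weighted averages -/

section Expect

variable {α β ι : Type*} [Fintype α] [Fintype β]

/-- The average of `f` with respect to the weights `q`. -/
def expect (q : α → ℝ) (f : α → ℝ) : ℝ := ∑ a, q a * f a

theorem expect_comm (q : α → ℝ) (q' : β → ℝ) (f : α → β → ℝ) :
    expect q (fun a => expect q' fun b => f a b) = expect q' fun b => expect q fun a => f a b := by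
  simp_rw [expect, Finset.mul_sum]
  rw [Finset.sum_comm]
  exact Finset.sum_congr rfl fun b _ => Finset.sum_congr rfl fun a _ => by ring

theorem expect_sum (q : α → ℝ) (s : Finset ι) (f : ι → α → ℝ) :
    expect q (fun a => ∑ i ∈ s, f i a) = ∑ i ∈ s, expect q (f i) := by
  simp_rw [expect, Finset.mul_sum]
  exact Finset.sum_comm

theorem expect_add (q : α → ℝ) (f g : α → ℝ) :
    expect q (fun a => f a + g a) = expect q f + expect q g := by
  simp_rw [expect, mul_add, Finset.sum_add_distrib]

theorem expect_mul_left (q : α → ℝ) (c : ℝ) (f : α → ℝ) :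
    expect q (fun a => c * f a) = c * expect q f := by
  simp_rw [expect, Finset.mul_sum]
  exact Finset.sum_congr rfl fun a _ => by ring

theorem expect_const {q : α → ℝ} (hq1 : ∑ a, q a = 1) (c : ℝ) : expect q (fun _ => c) = c := by
  rw [expect, ← Finset.sum_mul, hq1, one_mul]

theorem expect_eq_zero (q : α → ℝ) {f : α → ℝ} (h : ∀ a, f a = 0) : expect q f = 0 :=
  Finset.sum_eq_zero fun a _ => by rw [h a, mul_zero]

theorem expect_mono {q : α → ℝ} (hq : ∀ a, 0 ≤ q a) {f g : α → ℝ} (h : ∀ a, f a ≤ g a) :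
    expect q f ≤ expect q g :=
  Finset.sum_le_sum fun a _ => mul_le_mul_of_nonneg_left (h a) (hq a)

theorem expect_le {q : α → ℝ} (hq : ∀ a, 0 ≤ q a) (hq1 : ∑ a, q a = 1) {f : α → ℝ} {c : ℝ}
    (h : ∀ a, f a ≤ c) : expect q f ≤ c :=
  (expect_mono hq h).trans (expect_const hq1 c).le

theorem exists_le_of_expect_le {q : α → ℝ} (hq : ∀ a, 0 ≤ q a) (hq1 : ∑ a, q a = 1) {f : α → ℝ}
    {c : ℝ} (h : expect q f ≤ c) : ∃ a, f a ≤ c := by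
  by_contra! hlt
  obtain ⟨a, -, ha⟩ := Finset.exists_ne_zero_of_sum_ne_zero (hq1.trans_ne one_ne_zero)
  have : expect q (fun _ => c) < expect q f :=
    Finset.sum_lt_sum (fun a _ => mul_le_mul_of_nonneg_left (hlt a).le (hq a))
      ⟨a, mem_univ a, mul_lt_mul_of_pos_left (hlt a) ((hq a).lt_of_ne' ha)⟩
  rw [expect_const hq1] at this
  linarith

/-- The product of the weights `q a` on a finite function space. -/
def prodWeight {A : Type*} [Fintype A] {B : A → Type*} (q : ∀ a, B a → ℝ) (f : ∀ a, B a) : ℝ :=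
  ∏ a, q a (f a)

section

variable {A : Type*} [Fintype A] {B : A → Type*} {q : ∀ a, B a → ℝ}

theorem prodWeight_nonneg (hq : ∀ a b, 0 ≤ q a b) (f : ∀ a, B a) : 0 ≤ prodWeight q f :=
  Finset.prod_nonneg fun a _ => hq a _

variable [DecidableEq A] [∀ a, Fintype (B a)]

theorem sum_prodWeight (hq : ∀ a, ∑ b, q a b = 1) : ∑ f, prodWeight q f = 1 :=
  sum_prod_apply_eq_one hq

theorem expect_prodWeight_resample (a₀ : A) (hq : ∑ b, q a₀ b = 1)
    (g : (∀ a, B a) → B a₀ → ℝ) (hg : ∀ f u v, g (Function.update f a₀ u) v = g f v) :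
    expect (prodWeight q) (fun f => g f (f a₀)) =
      expect (prodWeight q) fun f => expect (q a₀) (g f) :=
  sum_prod_mul_resample a₀ hq g hg

theorem expect_prodWeight_apply (hq : ∀ a, ∑ b, q a b = 1) (a₀ : A) (h : B a₀ → ℝ) :
    expect (prodWeight q) (fun f => h (f a₀)) = expect (q a₀) h := by
  rw [expect_prodWeight_resample a₀ (hq a₀) (fun _ => h) fun _ _ _ => rfl,
    expect_const (sum_prodWeight hq)]

theorem expect_prodWeight_comp {J : Type*} [Fintype J] [DecidableEq J]
    (hq : ∀ a, ∑ b, q a b = 1) (e : J → A) (he : Function.Injective e)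
    (g : (∀ j, B (e j)) → ℝ) :
    expect (prodWeight q) (fun f => g fun j => f (e j)) =
      expect (prodWeight fun j => q (e j)) g :=
  sum_prod_mul_comp hq e he g

end

end Expect

/-! ### Codes for one block -/

/-- The code used in one block of length `n`, for `M` messages and `L i` words of relay `i`. Relay
`i` describes to the destination only the outputs that it receives at the times `k` with
`i ∈ mask k`: it transmits in the next block the `bin` of the sequence of these outputs. -/
structure BlockCode {N : ℕ} (𝒳 : Type*) (𝒳r 𝒴r : Fin N → Type*) (n M : ℕ) (L : Fin N → ℕ) where
  /-- the relays that describe their outputs -/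
  mask : Fin n → Finset (Fin N)
  /-- the words of the source -/
  enc : Fin M → Fin n → 𝒳
  /-- the words of the relays -/
  word : ∀ a : (Σ i, Fin (L i)), Fin n → 𝒳r a.1
  /-- the bins of the masked outputs -/
  bin : ∀ a : (Σ i, Fin n → 𝒴r i), Fin (L a.1)

/-- The scores and the exponents of the thresholds by which the destination recognizes the words of
the relays, the masked outputs of the relays and the word of the source. -/
structure Tests {N : ℕ} (𝒳 𝒴 : Type*) (𝒳r 𝒴r : Fin N → Type*)
    (precX precY : Fin N → Fin N → Prop) where
  /-- the score of an input of relay `i`, given the output at the destination and the inputs of the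
  relays before `i` -/
  relay : ∀ i, 𝒳r i → 𝒴 × (∀ j : before precX i, 𝒳r j) → ℝ
  /-- the score of a masked output of relay `i`, given the inputs of the relays, the output at the
  destination and the masked outputs of the relays before `i` -/
  index : Finset (Fin N) → ∀ i, 𝒴r i → ((∀ i, 𝒳r i) × 𝒴) × (∀ j : before precY i, 𝒴r j) → ℝ
  /-- the score of an input of the source, given the inputs of the relays, the output at the
  destination and the masked outputs of the relays -/
  source : Finset (Fin N) → 𝒳 → ((∀ i, 𝒳r i) × 𝒴) × (∀ i, 𝒴r i) → ℝ
  /-- the exponents for the words of the relays -/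
  relayExp : Fin N → ℝ
  /-- the exponents for the masked outputs of the relays -/
  indexExp : Fin N → ℝ
  /-- the exponent for the word of the source -/
  sourceExp : ℝ

section Block

variable {N : ℕ} {𝒳 𝒴 : Type*} {𝒳r 𝒴r : Fin N → Type*}
  {n M : ℕ} {L : Fin N → ℕ}

/-- The outputs `y` of the relays, replaced by `y₀` outside of the set `θ`. -/
def maskOut (y₀ : ∀ i, 𝒴r i) (θ : Finset (Fin N)) (y : ∀ i, 𝒴r i) : ∀ i, 𝒴r i :=
  fun i => if i ∈ θ then y i else y₀ i

namespace BlockCode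

/-- The inputs of the relays at time `k` if the relays send the words with indices `s`. -/
def input (D : BlockCode 𝒳 𝒳r 𝒴r n M L) (s : ∀ i, Fin (L i)) (k : Fin n) : ∀ i, 𝒳r i :=
  fun i => D.word ⟨i, s i⟩ k

/-- The masked outputs of relay `i`. -/
def masked (y₀ : ∀ i, 𝒴r i) (D : BlockCode 𝒳 𝒳r 𝒴r n M L) (ω : Fin n → 𝒴 × (∀ i, 𝒴r i))
    (i : Fin N) : Fin n → 𝒴r i :=
  fun k => maskOut y₀ (D.mask k) (ω k).2 i

/-- The index that relay `i` transmits in the next block, as a function of its outputs. -/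
def index (y₀ : ∀ i, 𝒴r i) (D : BlockCode 𝒳 𝒳r 𝒴r n M L) (i : Fin N) (y : Fin n → 𝒴r i) :
    Fin (L i) :=
  D.bin ⟨i, fun k => if i ∈ D.mask k then y k else y₀ i⟩

theorem index_eq_bin_masked (y₀ : ∀ i, 𝒴r i) (D : BlockCode 𝒳 𝒳r 𝒴r n M L)
    (ω : Fin n → 𝒴 × (∀ i, 𝒴r i)) (i : Fin N) :
    D.index y₀ i (fun k => (ω k).2 i) = D.bin ⟨i, D.masked y₀ ω i⟩ := rfl

variable [Fintype 𝒴] [∀ i, Fintype (𝒴r i)]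

/-- The probability of the outputs `ω` in a block with message `w` and relay indices `s`. -/
def prob (ch : RelayChannel 𝒳 𝒴 𝒳r 𝒴r) (D : BlockCode 𝒳 𝒳r 𝒴r n M L) (s : ∀ i, Fin (L i))
    (w : Fin M) (ω : Fin n → 𝒴 × (∀ i, 𝒴r i)) : ℝ :=
  ∏ k, ch.prob (D.enc w k) (D.input s k) (ω k)

theorem prob_nonneg (ch : RelayChannel 𝒳 𝒴 𝒳r 𝒴r) (D : BlockCode 𝒳 𝒳r 𝒴r n M L)
    (s : ∀ i, Fin (L i)) (w : Fin M) (ω : Fin n → 𝒴 × (∀ i, 𝒴r i)) : 0 ≤ D.prob ch s w ω :=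
  Finset.prod_nonneg fun _ _ => (ch.prob_mem _ _).1 _

theorem sum_prob (ch : RelayChannel 𝒳 𝒴 𝒳r 𝒴r) (D : BlockCode 𝒳 𝒳r 𝒴r n M L)
    (s : ∀ i, Fin (L i)) (w : Fin M) : ∑ ω, D.prob ch s w ω = 1 :=
  sum_prod_apply_eq_one (q := fun k => ch.prob (D.enc w k) (D.input s k))
    fun _ => (ch.prob_mem _ _).2

end BlockCode

variable {precX precY : Fin N → Fin N → Prop}

namespace Tests

variable (t : Tests 𝒳 𝒴 𝒳r 𝒴r precX precY) (y₀ : ∀ i, 𝒴r i) (D : BlockCode 𝒳 𝒳r 𝒴r n M L)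
  (s : ∀ i, Fin (L i)) (ω : Fin n → 𝒴 × (∀ i, 𝒴r i))

/-- The score of the word `u` of relay `i`. -/
def relayScore (i : Fin N) (u : Fin n → 𝒳r i) : ℝ :=
  ∏ k, t.relay i (u k) ((ω k).1, fun j => D.input s k j)

/-- The score of the masked outputs `u` of relay `i`. -/
def indexScore (i : Fin N) (u : Fin n → 𝒴r i) : ℝ :=
  ∏ k, t.index (D.mask k) i (u k)
    ((D.input s k, (ω k).1), fun j => maskOut y₀ (D.mask k) (ω k).2 j)

/-- The score of the word `u` of the source. -/
def sourceScore (u : Fin n → 𝒳) : ℝ :=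
  ∏ k, t.source (D.mask k) (u k) ((D.input s k, (ω k).1), maskOut y₀ (D.mask k) (ω k).2)

/-- In the block with message `w`, relay indices `s` and outputs `ω`, the true words and masked
outputs pass their tests, and no other candidate does. In the tests for relay `i`, the words and
masked outputs of the relays before `i` are the true ones. -/
structure Good (w : Fin M) : Prop where
  relay_pass : ∀ i, (2 : ℝ) ^ (n * t.relayExp i) < t.relayScore D s ω i (D.word ⟨i, s i⟩)
  relay_unique : ∀ i s', (2 : ℝ) ^ (n * t.relayExp i) < t.relayScore D s ω i (D.word ⟨i, s'⟩) →
    s' = s i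
  index_pass : ∀ i, (2 : ℝ) ^ (n * t.indexExp i) < t.indexScore y₀ D s ω i (D.masked y₀ ω i)
  index_unique : ∀ i u, D.bin ⟨i, u⟩ = D.bin ⟨i, D.masked y₀ ω i⟩ →
    (2 : ℝ) ^ (n * t.indexExp i) < t.indexScore y₀ D s ω i u → u = D.masked y₀ ω i
  source_pass : (2 : ℝ) ^ (n * t.sourceExp) < t.sourceScore y₀ D s ω (D.enc w)
  source_unique : ∀ w', (2 : ℝ) ^ (n * t.sourceExp) < t.sourceScore y₀ D s ω (D.enc w') → w' = w

variable {t y₀ D s ω}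

/-- Successive decoding of the relay words: in a good block, the outputs at the destination
determine the relay indices. -/
theorem Good.relay_eq [IsStrictOrder (Fin N) precX] {s' : ∀ i, Fin (L i)}
    {ω' : Fin n → 𝒴 × (∀ i, 𝒴r i)} {w w' : Fin M} (h : t.Good y₀ D s ω w)
    (h' : t.Good y₀ D s' ω' w') (hy : ∀ k, (ω k).1 = (ω' k).1) : s = s' := by
  funext i
  refine (Finite.wellFounded_of_trans_of_irrefl precX).induction (C := fun i => s i = s' i) i ?_
  intro i ih
  refine (h.relay_unique i (s' i) ?_).symm
  convert h'.relay_pass i using 1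
  refine Finset.prod_congr rfl fun k _ => ?_
  rw [hy k]
  congr 2
  funext j
  have hj : precX j i := by simpa [before] using j.2
  rw [BlockCode.input, BlockCode.input, ih j hj]

/-- Successive decoding of the masked relay outputs: in a good block, they are determined by their
bins, the relay indices and the outputs at the destination. -/
theorem Good.masked_eq [IsStrictOrder (Fin N) precY]
    {ω' : Fin n → 𝒴 × (∀ i, 𝒴r i)} {w w' : Fin M} (h : t.Good y₀ D s ω w)
    (h' : t.Good y₀ D s ω' w') (hy : ∀ k, (ω k).1 = (ω' k).1)
    (hb : ∀ i, D.index y₀ i (fun k => (ω k).2 i) = D.index y₀ i (fun k => (ω' k).2 i))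
    (i : Fin N) : D.masked y₀ ω i = D.masked y₀ ω' i := by
  refine (Finite.wellFounded_of_trans_of_irrefl precY).induction
    (C := fun i => D.masked y₀ ω i = D.masked y₀ ω' i) i ?_
  intro i ih
  refine (h.index_unique i _ ?_ ?_).symm
  · rw [← BlockCode.index_eq_bin_masked, ← BlockCode.index_eq_bin_masked, hb i]
  · convert h'.index_pass i using 1
    refine Finset.prod_congr rfl fun k _ => ?_
    rw [hy k]
    congr 2
    funext j
    have hj : precY j i := by simpa [before] using j.2
    exact congrFun (ih j hj) k

theorem Good.source_eq [IsStrictOrder (Fin N) precY]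
    {ω' : Fin n → 𝒴 × (∀ i, 𝒴r i)} {w w' : Fin M} (h : t.Good y₀ D s ω w)
    (h' : t.Good y₀ D s ω' w') (hy : ∀ k, (ω k).1 = (ω' k).1)
    (hb : ∀ i, D.index y₀ i (fun k => (ω k).2 i) = D.index y₀ i (fun k => (ω' k).2 i)) :
    w = w' := by
  refine (h.source_unique w' ?_).symm
  convert h'.source_pass using 1
  refine Finset.prod_congr rfl fun k _ => ?_
  rw [hy k]
  congr 2
  funext i
  exact congrFun (h.masked_eq h' hy hb i) k

end Tests

end Block

/-! ### Random codes for one block -/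

theorem sum_subsetProb {N : ℕ} (q : Fin N → ℝ) (T : Finset (Fin N)) :
    ∑ S ∈ T.powerset, subsetProb q T S = 1 := by
  simp_rw [subsetProb, ← Finset.prod_add]
  simp

theorem subsetProb_nonneg {N : ℕ} {q : Fin N → ℝ} {T S : Finset (Fin N)} (hST : S ⊆ T)
    (hq0 : ∀ i ∈ T, 0 ≤ q i) (hq1 : ∀ i ∈ T, q i ≤ 1) : 0 ≤ subsetProb q T S :=
  mul_nonneg (Finset.prod_nonneg fun i hi => hq0 i (hST hi))
    (Finset.prod_nonneg fun i hi => sub_nonneg.2 (hq1 i (Finset.mem_sdiff.1 hi).1))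

section RandomCode

variable {N : ℕ} {𝒳 𝒴 : Type*} {𝒳r 𝒴r : Fin N → Type*}
  [Fintype 𝒳] [Fintype 𝒴] [∀ i, Fintype (𝒳r i)] [∀ i, Fintype (𝒴r i)]
  {n M : ℕ} {L : Fin N → ℕ}

/-- The weight `∏ k, q (u k)` of a sequence of independent symbols. -/
abbrev wordWeight {α : Type*} (n : ℕ) (q : α → ℝ) : (Fin n → α) → ℝ :=
  prodWeight fun _ : Fin n => q

open Classical in
/-- The average over all codes for one block: the masks, the symbols of the words and the bins are
independent, a mask contains relay `i` with probability `q i`, the symbols of the source and of the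
relays have the distributions `p` and `pr i`, and the bins are uniformly distributed. -/
noncomputable def codeExpect (q : Fin N → ℝ) (p : 𝒳 → ℝ) (pr : ∀ i, 𝒳r i → ℝ)
    (F : BlockCode 𝒳 𝒳r 𝒴r n M L → ℝ) : ℝ :=
  expect (wordWeight n (subsetProb q univ)) fun θ =>
    expect (prodWeight fun _ : Fin M => wordWeight n p) fun e =>
      expect (prodWeight fun a : (Σ i, Fin (L i)) => wordWeight n (pr a.1)) fun g =>
        expect (prodWeight fun (a : Σ i, Fin n → 𝒴r i) (_ : Fin (L a.1)) => (L a.1 : ℝ)⁻¹)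
          fun b => F ⟨θ, e, g, b⟩

/-- The distribution of the mask and the outcome at one time. -/
noncomputable def maskedJoint (ch : RelayChannel 𝒳 𝒴 𝒳r 𝒴r) (q : Fin N → ℝ) (p : 𝒳 → ℝ)
    (pr : ∀ i, 𝒳r i → ℝ) (o : Finset (Fin N) × Outcome 𝒳 𝒴 𝒳r 𝒴r) : ℝ :=
  subsetProb q univ o.1 * ch.joint p pr o.2

theorem sum_wordWeight {α : Type*} [Fintype α] (n : ℕ) {q : α → ℝ} (hq : ∑ a, q a = 1) :
    ∑ u, wordWeight n q u = 1 := sum_prodWeight fun _ => hq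

theorem wordWeight_nonneg {α : Type*} {q : α → ℝ} (hq : ∀ a, 0 ≤ q a) (u : Fin n → α) :
    0 ≤ wordWeight n q u := prodWeight_nonneg (fun _ => hq) u

theorem sum_inv_card_fin {l : ℕ} (hl : 0 < l) : ∑ _b : Fin l, (l : ℝ)⁻¹ = 1 := by
  have : (l : ℝ) ≠ 0 := by positivity
  simp [this]

theorem sum_subsetProb_univ (q : Fin N → ℝ) : ∑ θ, subsetProb q univ θ = 1 := by
  rw [← sum_subsetProb q univ, Finset.powerset_univ]

variable {q : Fin N → ℝ} {p : 𝒳 → ℝ} {pr : ∀ i, 𝒳r i → ℝ}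

theorem codeExpect_sum {ι : Type*} (s : Finset ι) (F : ι → BlockCode 𝒳 𝒳r 𝒴r n M L → ℝ) :
    codeExpect q p pr (fun D => ∑ i ∈ s, F i D) = ∑ i ∈ s, codeExpect q p pr (F i) := by
  simp_rw [codeExpect, expect_sum]

theorem codeExpect_add (F G : BlockCode 𝒳 𝒳r 𝒴r n M L → ℝ) :
    codeExpect q p pr (fun D => F D + G D) = codeExpect q p pr F + codeExpect q p pr G := by
  simp_rw [codeExpect, expect_add]

theorem codeExpect_mul_left (c : ℝ) (F : BlockCode 𝒳 𝒳r 𝒴r n M L → ℝ) :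
    codeExpect q p pr (fun D => c * F D) = c * codeExpect q p pr F := by
  simp_rw [codeExpect, expect_mul_left]

section

variable (hq : ∀ i, 0 ≤ q i ∧ q i ≤ 1) (hp : p ∈ stdSimplex ℝ 𝒳)
  (hpr : ∀ i, pr i ∈ stdSimplex ℝ (𝒳r i))

include hpr in
theorem wordsWeight_nonneg (g : ∀ a : (Σ i, Fin (L i)), Fin n → 𝒳r a.1) :
    0 ≤ prodWeight (fun a : (Σ i, Fin (L i)) => wordWeight n (pr a.1)) g :=
  prodWeight_nonneg (fun a => wordWeight_nonneg (hpr a.1).1) g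

include hpr in
theorem sum_wordsWeight :
    ∑ g : (∀ a : (Σ i, Fin (L i)), Fin n → 𝒳r a.1),
      prodWeight (fun a : (Σ i, Fin (L i)) => wordWeight n (pr a.1)) g = 1 :=
  sum_prodWeight fun a => sum_wordWeight n (hpr a.1).2

theorem sum_binsWeight (hL : ∀ i, 0 < L i) [DecidableEq (Σ i, Fin n → 𝒴r i)] :
    ∑ b : (∀ a : (Σ i, Fin n → 𝒴r i), Fin (L a.1)),
      prodWeight (fun (a : Σ i, Fin n → 𝒴r i) (_ : Fin (L a.1)) => (L a.1 : ℝ)⁻¹) b = 1 :=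
  sum_prodWeight fun a => sum_inv_card_fin (hL a.1)

include hq in
theorem subsetProb_univ_nonneg (θ : Finset (Fin N)) : 0 ≤ subsetProb q univ θ :=
  subsetProb_nonneg (Finset.subset_univ _) (fun i _ => (hq i).1) fun i _ => (hq i).2

include hq hp hpr in
theorem codeExpect_mono {F G : BlockCode 𝒳 𝒳r 𝒴r n M L → ℝ} (h : ∀ D, F D ≤ G D) :
    codeExpect q p pr F ≤ codeExpect q p pr G := by
  classical
  exact expect_mono (wordWeight_nonneg (subsetProb_univ_nonneg hq)) fun θ =>
    expect_mono (prodWeight_nonneg fun _ => wordWeight_nonneg hp.1) fun e =>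
    expect_mono (wordsWeight_nonneg hpr) fun g =>
    expect_mono (prodWeight_nonneg fun _ _ => by positivity) fun b => h ⟨θ, e, g, b⟩

include hq hp hpr in
theorem exists_le_of_codeExpect_le (hL : ∀ i, 0 < L i) {F : BlockCode 𝒳 𝒳r 𝒴r n M L → ℝ} {c : ℝ}
    (h : codeExpect q p pr F ≤ c) : ∃ D, F D ≤ c := by
  classical
  obtain ⟨θ, h⟩ := exists_le_of_expect_le (wordWeight_nonneg (subsetProb_univ_nonneg hq))
    (sum_wordWeight n (sum_subsetProb_univ q)) h
  obtain ⟨e, h⟩ := exists_le_of_expect_le (prodWeight_nonneg fun _ => wordWeight_nonneg hp.1)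
    (sum_prodWeight fun _ => sum_wordWeight n hp.2) h
  obtain ⟨g, h⟩ := exists_le_of_expect_le
    (wordsWeight_nonneg hpr) (sum_wordsWeight hpr) h
  obtain ⟨b, h⟩ := exists_le_of_expect_le (prodWeight_nonneg fun _ _ => by positivity)
    (sum_binsWeight hL) h
  exact ⟨_, h⟩

/-- Sequences of pairs of a mask and an outcome, as tuples of sequences. -/
def outcomeSeqEquiv (n : ℕ) : (Fin n → Finset (Fin N) × Outcome 𝒳 𝒴 𝒳r 𝒴r) ≃
    (Fin n → Finset (Fin N)) × (Fin n → 𝒳) × (∀ i, Fin n → 𝒳r i) ×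
      (Fin n → 𝒴 × (∀ i, 𝒴r i)) where
  toFun o := (fun k => (o k).1, fun k => (o k).2.1, fun i k => (o k).2.2.1 i,
    fun k => (o k).2.2.2)
  invFun x := fun k => (x.1 k, x.2.1 k, fun i => x.2.2.1 i k, x.2.2.2 k)
  left_inv _ := rfl
  right_inv _ := rfl

include hp hpr in
/-- Averaged over all codes, the mask, the transmitted symbols and the outputs are independent
over time, whatever the message and the relay indices are. -/
theorem codeExpect_expect_prob (ch : RelayChannel 𝒳 𝒴 𝒳r 𝒴r) (hL : ∀ i, 0 < L i)
    (s : ∀ i, Fin (L i)) (w : Fin M)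
    (F : (Fin n → Finset (Fin N)) → (Fin n → 𝒳) → (∀ i, Fin n → 𝒳r i) →
      (Fin n → 𝒴 × (∀ i, 𝒴r i)) → ℝ) :
    codeExpect q p pr (fun D : BlockCode 𝒳 𝒳r 𝒴r n M L => expect (D.prob ch s w) fun ω =>
        F D.mask (D.enc w) (fun i => D.word ⟨i, s i⟩) ω) =
      expect (wordWeight n (maskedJoint ch q p pr)) fun o =>
        F (fun k => (o k).1) (fun k => srcIn (o k).2) (fun i k => relayIn i (o k).2)
          fun k => (o k).2.2.2 := by
  classical
  have h1 : ∀ (θ : Fin n → Finset (Fin N)) (e : Fin M → Fin n → 𝒳)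
      (g : ∀ a : (Σ i, Fin (L i)), Fin n → 𝒳r a.1),
      expect (prodWeight fun (a : Σ i, Fin n → 𝒴r i) (_ : Fin (L a.1)) => (L a.1 : ℝ)⁻¹)
        (fun b => expect (BlockCode.prob ch ⟨θ, e, g, b⟩ s w) fun ω =>
          F θ (e w) (fun i => g ⟨i, s i⟩) ω) =
      expect (fun ω => ∏ k, ch.prob (e w k) (fun i => g ⟨i, s i⟩ k) (ω k)) fun ω =>
        F θ (e w) (fun i => g ⟨i, s i⟩) ω := by
    intro θ e g
    have h := sum_binsWeight (n := n) (𝒴r := 𝒴r) hL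
    have hK : ∀ b, BlockCode.prob ch ⟨θ, e, g, b⟩ s w =
      fun ω => ∏ k, ch.prob (e w k) (fun i => g ⟨i, s i⟩ k) (ω k) := fun _ => rfl
    simp_rw [hK]
    exact expect_const h _
  have h2 : ∀ (θ : Fin n → Finset (Fin N)) (e : Fin M → Fin n → 𝒳),
      expect (prodWeight fun a : (Σ i, Fin (L i)) => wordWeight n (pr a.1)) (fun g =>
        expect (fun ω => ∏ k, ch.prob (e w k) (fun i => g ⟨i, s i⟩ k) (ω k)) fun ω =>
          F θ (e w) (fun i => g ⟨i, s i⟩) ω) =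
      expect (prodWeight fun i => wordWeight n (pr i)) fun xr =>
        expect (fun ω => ∏ k, ch.prob (e w k) (fun i => xr i k) (ω k)) fun ω =>
          F θ (e w) xr ω := by
    intro θ e
    have h := expect_prodWeight_comp (B := fun a : (Σ i, Fin (L i)) => Fin n → 𝒳r a.1)
      (q := fun a : (Σ i, Fin (L i)) => wordWeight n (pr a.1))
      (fun a => sum_wordWeight n (hpr a.1).2) (fun i => (⟨i, s i⟩ : Σ i, Fin (L i)))
      (fun i j h => congrArg Sigma.fst h)
      (fun xr => expect (fun ω => ∏ k, ch.prob (e w k) (fun i => xr i k) (ω k)) fun ω =>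
          F θ (e w) xr ω)
    exact h
  have h3 : ∀ (θ : Fin n → Finset (Fin N)),
      expect (prodWeight fun _ : Fin M => wordWeight n p) (fun e =>
        expect (prodWeight fun i => wordWeight n (pr i)) fun xr =>
        expect (fun ω => ∏ k, ch.prob (e w k) (fun i => xr i k) (ω k)) fun ω =>
          F θ (e w) xr ω) =
      expect (wordWeight n p) fun x => expect (prodWeight fun i => wordWeight n (pr i)) fun xr =>
        expect (fun ω => ∏ k, ch.prob (x k) (fun i => xr i k) (ω k)) fun ω => F θ x xr ω := by
    intro θ
    have h := expect_prodWeight_apply (B := fun _ : Fin M => Fin n → 𝒳)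
      (q := fun _ : Fin M => wordWeight n p)
      (fun _ => sum_wordWeight n hp.2) w (fun x =>
        expect (prodWeight fun i => wordWeight n (pr i)) fun xr =>
        expect (fun ω => ∏ k, ch.prob (x k) (fun i => xr i k) (ω k)) fun ω => F θ x xr ω)
    exact h
  have h4 : codeExpect q p pr (fun D : BlockCode 𝒳 𝒳r 𝒴r n M L =>
      expect (D.prob ch s w) fun ω =>
        F D.mask (D.enc w) (fun i => D.word ⟨i, s i⟩) ω) =
      expect (wordWeight n (subsetProb q univ)) fun θ =>
        expect (wordWeight n p) fun x => expect (prodWeight fun i => wordWeight n (pr i)) fun xr =>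
        expect (fun ω => ∏ k, ch.prob (x k) (fun i => xr i k) (ω k)) fun ω => F θ x xr ω := by
    simp_rw [← h3, ← h2, ← h1]
    rfl
  rw [h4]
  simp_rw [expect, Finset.mul_sum, ← Fintype.sum_prod_type']
  refine (Fintype.sum_equiv (outcomeSeqEquiv n) _ _ fun o => ?_).symm
  simp only [outcomeSeqEquiv, Equiv.coe_fn_mk, prodWeight, maskedJoint, RelayChannel.joint, srcIn,
    relayIn, Finset.prod_mul_distrib]
  rw [Finset.prod_comm]
  ring

end

end RandomCode

/-! ### The error probability of a random code for one block -/

section BlockError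

variable {N : ℕ} {𝒳 𝒴 : Type*} {𝒳r 𝒴r : Fin N → Type*}
  [Fintype 𝒳] [Fintype 𝒴] [∀ i, Fintype (𝒳r i)] [∀ i, Fintype (𝒴r i)]
  {n M : ℕ} {L : Fin N → ℕ} {precX precY : Fin N → Fin N → Prop}

/-- The scores are nonnegative and normalized like conditional densities with respect to the
distributions of the random words, or to the counting measure in the case of the masked outputs;
a relay outside of the mask is known to have the masked output `y₀`. -/
structure Tests.Normalized (t : Tests 𝒳 𝒴 𝒳r 𝒴r precX precY) (p : 𝒳 → ℝ)
    (pr : ∀ i, 𝒳r i → ℝ) (y₀ : ∀ i, 𝒴r i) : Prop where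
  relay_nonneg : ∀ i u v, 0 ≤ t.relay i u v
  relay_sum : ∀ i v, ∑ u, pr i u * t.relay i u v ≤ 1
  index_nonneg : ∀ θ i u v, 0 ≤ t.index θ i u v
  index_sum : ∀ θ i v, ∑ u, t.index θ i u v ≤ 1
  index_eq : ∀ θ i u v, i ∉ θ → t.index θ i u v ≠ 0 → u = y₀ i
  source_nonneg : ∀ θ u v, 0 ≤ t.source θ u v
  source_sum : ∀ θ v, ∑ u, p u * t.source θ u v ≤ 1

variable {q : Fin N → ℝ} {p : 𝒳 → ℝ} {pr : ∀ i, 𝒳r i → ℝ} {y₀ : ∀ i, 𝒴r i}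
  {t : Tests 𝒳 𝒴 𝒳r 𝒴r precX precY} (ch : RelayChannel 𝒳 𝒴 𝒳r 𝒴r)
  (hq : ∀ i, 0 ≤ q i ∧ q i ≤ 1) (hp : p ∈ stdSimplex ℝ 𝒳)
  (hpr : ∀ i, pr i ∈ stdSimplex ℝ (𝒳r i)) (hL : ∀ i, 0 < L i)
  (ht : t.Normalized p pr y₀) (s : ∀ i, Fin (L i)) (w : Fin M)

theorem two_rpow_pos (x : ℝ) : (0 : ℝ) < 2 ^ x := Real.rpow_pos_of_pos two_pos x

include hq hp hpr hL ht in
/-- A false word of relay `i` passes its test with small probability. There is no false word for the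
index `s i` itself. -/
theorem codeExpect_relay_false_le (i : Fin N) (s' : Fin (L i)) :
    codeExpect q p pr (fun D : BlockCode 𝒳 𝒳r 𝒴r n M L => expect (D.prob ch s w) fun ω =>
      ind (s' ≠ s i ∧
        (2 : ℝ) ^ (n * t.relayExp i) < t.relayScore D s ω i (D.word ⟨i, s'⟩))) ≤
      if s' = s i then 0 else ((2 : ℝ) ^ (n * t.relayExp i))⁻¹ := by
  classical
  split_ifs with hs
  · unfold codeExpect
    exact (expect_eq_zero _ fun θ => expect_eq_zero _ fun e => expect_eq_zero _ fun g =>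
      expect_eq_zero _ fun b => expect_eq_zero _ fun ω => ind_of_false fun h => h.1 hs).le
  simp only [ne_eq, hs, not_false_eq_true, true_and]
  refine expect_le (wordWeight_nonneg (subsetProb_univ_nonneg hq))
    (sum_wordWeight n (sum_subsetProb_univ q)) fun θ => ?_
  refine expect_le (prodWeight_nonneg fun _ => wordWeight_nonneg hp.1)
    (sum_prodWeight fun _ => sum_wordWeight n hp.2) fun e => ?_
  rw [expect_comm]
  refine expect_le (prodWeight_nonneg fun _ _ => by positivity) (sum_binsWeight hL) fun b => ?_
  -- the false word is not transmitted, so that it may be replaced by an independent one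
  have hin : ∀ (g : ∀ a : (Σ i, Fin (L i)), Fin n → 𝒳r a.1) (u : Fin n → 𝒳r i),
      BlockCode.input (𝒴r := 𝒴r) ⟨θ, e, Function.update g ⟨i, s'⟩ u, b⟩ s =
        BlockCode.input ⟨θ, e, g, b⟩ s := by
    intro g u
    funext k j
    have hj : (⟨j, s j⟩ : Σ i, Fin (L i)) ≠ ⟨i, s'⟩ := by
      rintro h
      obtain rfl := congrArg Sigma.fst h
      exact hs (by simpa using h.symm)
    simp only [BlockCode.input, Function.update_of_ne hj]
  have h := expect_prodWeight_resample (B := fun a : (Σ i, Fin (L i)) => Fin n → 𝒳r a.1)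
    (q := fun a : (Σ i, Fin (L i)) => wordWeight n (pr a.1)) ⟨i, s'⟩
    (sum_wordWeight n (hpr i).2)
    (fun g u => expect (BlockCode.prob ch ⟨θ, e, g, b⟩ s w) fun ω =>
      ind ((2 : ℝ) ^ (n * t.relayExp i) < t.relayScore ⟨θ, e, g, b⟩ s ω i u)) (by
      intro g u v
      have hprob : BlockCode.prob ch ⟨θ, e, Function.update g ⟨i, s'⟩ u, b⟩ s w =
          BlockCode.prob ch ⟨θ, e, g, b⟩ s w := by
        funext ω
        simp only [BlockCode.prob, hin]
      simp only [Tests.relayScore, hprob, hin])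
  refine h.le.trans (expect_le (wordsWeight_nonneg hpr) (sum_wordsWeight hpr) fun g => ?_)
  rw [expect_comm]
  refine expect_le (BlockCode.prob_nonneg ch _ s w) (BlockCode.sum_prob ch _ s w) fun ω => ?_
  exact sum_prod_mul_threshold_le (pr i) (hpr i).1
    (fun k u => t.relay i u ((ω k).1, fun j => BlockCode.input ⟨θ, e, g, b⟩ s k j))
    (fun k u => ht.relay_nonneg _ _ _) (fun k => ht.relay_sum _ _) (two_rpow_pos _)

include hq hp hpr hL ht in
/-- The word of a false message passes the test for the source with small probability. -/
theorem codeExpect_source_false_le (w' : Fin M) :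
    codeExpect q p pr (fun D : BlockCode 𝒳 𝒳r 𝒴r n M L => expect (D.prob ch s w) fun ω =>
      ind (w' ≠ w ∧
        (2 : ℝ) ^ (n * t.sourceExp) < t.sourceScore y₀ D s ω (D.enc w'))) ≤
      ((2 : ℝ) ^ (n * t.sourceExp))⁻¹ := by
  classical
  by_cases hw : w' = w
  · unfold codeExpect
    exact (expect_eq_zero _ fun θ => expect_eq_zero _ fun e => expect_eq_zero _ fun g =>
      expect_eq_zero _ fun b => expect_eq_zero _ fun ω => ind_of_false fun h => h.1 hw).le.trans
      (inv_nonneg.2 (two_rpow_pos _).le)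
  simp only [ne_eq, hw, not_false_eq_true, true_and]
  refine expect_le (wordWeight_nonneg (subsetProb_univ_nonneg hq))
    (sum_wordWeight n (sum_subsetProb_univ q)) fun θ => ?_
  rw [expect_comm]
  refine expect_le (wordsWeight_nonneg hpr) (sum_wordsWeight hpr) fun g => ?_
  rw [expect_comm]
  refine expect_le (prodWeight_nonneg fun _ _ => by positivity) (sum_binsWeight hL) fun b => ?_
  -- the word of a false message may be replaced by an independent one
  have h := expect_prodWeight_resample (B := fun _ : Fin M => Fin n → 𝒳)
    (q := fun _ : Fin M => wordWeight n p) w' (sum_wordWeight n hp.2)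
    (fun e u => expect (BlockCode.prob ch ⟨θ, e, g, b⟩ s w) fun ω =>
      ind ((2 : ℝ) ^ (n * t.sourceExp) < t.sourceScore y₀ ⟨θ, e, g, b⟩ s ω u)) (by
      intro e u v
      have hprob : BlockCode.prob ch ⟨θ, Function.update e w' u, g, b⟩ s w =
          BlockCode.prob ch ⟨θ, e, g, b⟩ s w := by
        funext ω
        simp only [BlockCode.prob, Function.update_of_ne (Ne.symm hw)]
        rfl
      rw [hprob]
      rfl)
  refine h.le.trans (expect_le (prodWeight_nonneg fun _ => wordWeight_nonneg hp.1)
    (sum_prodWeight fun _ => sum_wordWeight n hp.2) fun e => ?_)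
  rw [expect_comm]
  refine expect_le (BlockCode.prob_nonneg ch _ s w) (BlockCode.sum_prob ch _ s w) fun ω => ?_
  exact sum_prod_mul_threshold_le p hp.1
    (fun k u => t.source (θ k) u
      ((BlockCode.input ⟨θ, e, g, b⟩ s k, (ω k).1), maskOut y₀ (θ k) (ω k).2))
    (fun k u => ht.source_nonneg _ _ _) (fun k => ht.source_sum _ _) (two_rpow_pos _)

include hq hp hpr hL ht in
/-- A relay `i` with `q i = 0` has the masked output `y₀` at all times; for the other relays, a
false sequence is in the bin of the true one with probability `1 / L i`. -/
theorem codeExpect_index_false_le (i : Fin N) :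
    codeExpect q p pr (fun D : BlockCode 𝒳 𝒳r 𝒴r n M L => expect (D.prob ch s w) fun ω =>
      ∑ u, ind (u ≠ D.masked y₀ ω i ∧ D.bin ⟨i, u⟩ = D.bin ⟨i, D.masked y₀ ω i⟩ ∧
        (2 : ℝ) ^ (n * t.indexExp i) < t.indexScore y₀ D s ω i u)) ≤
      if q i = 0 then 0 else (L i : ℝ)⁻¹ * ((2 : ℝ) ^ (n * t.indexExp i))⁻¹ := by
  classical
  split_ifs with hqi
  · -- the masks that contain `i` at some time have weight `0`
    refine Finset.sum_nonpos fun θ _ => ?_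
    by_cases hθ : ∀ k, i ∉ θ k
    · refine (mul_eq_zero_of_right _ ?_).le
      refine expect_eq_zero _ fun e => expect_eq_zero _ fun g => expect_eq_zero _ fun b =>
        expect_eq_zero _ fun ω => ?_
      refine Finset.sum_eq_zero fun u _ => ind_of_false ?_
      rintro ⟨hne, -, hlt⟩
      refine hne (funext fun k => ?_)
      have h0 := (Finset.prod_ne_zero_iff.1 ((two_rpow_pos _).trans hlt).ne') k (mem_univ k)
      rw [ht.index_eq _ _ _ _ (hθ k) h0]
      simp [BlockCode.masked, maskOut, hθ k]
    · push Not at hθ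
      obtain ⟨k, hk⟩ := hθ
      refine (mul_eq_zero_of_left ?_ _).le
      exact Finset.prod_eq_zero (mem_univ k)
        (mul_eq_zero_of_left (Finset.prod_eq_zero hk hqi) _)
  refine expect_le (wordWeight_nonneg (subsetProb_univ_nonneg hq))
    (sum_wordWeight n (sum_subsetProb_univ q)) fun θ => ?_
  refine expect_le (prodWeight_nonneg fun _ => wordWeight_nonneg hp.1)
    (sum_prodWeight fun _ => sum_wordWeight n hp.2) fun e => ?_
  refine expect_le (wordsWeight_nonneg hpr) (sum_wordsWeight hpr) fun g => ?_
  set K : (Fin n → 𝒴 × (∀ i, 𝒴r i)) → ℝ :=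
    fun ω => ∏ k, ch.prob (e w k) (fun i => g ⟨i, s i⟩ k) (ω k) with hK
  set m : (Fin n → 𝒴 × (∀ i, 𝒴r i)) → Fin n → 𝒴r i :=
    fun ω k => maskOut y₀ (θ k) (ω k).2 i with hm
  set σ : (Fin n → 𝒴 × (∀ i, 𝒴r i)) → (Fin n → 𝒴r i) → ℝ := fun ω u =>
    ∏ k, t.index (θ k) i (u k) ((fun i => g ⟨i, s i⟩ k, (ω k).1),
      fun j => maskOut y₀ (θ k) (ω k).2 j) with hσ
  change expect _ (fun b : ∀ a : (Σ i, Fin n → 𝒴r i), Fin (L a.1) => expect K fun ω =>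
    ∑ u, ind (u ≠ m ω ∧ b ⟨i, u⟩ = b ⟨i, m ω⟩ ∧ (2 : ℝ) ^ (n * t.indexExp i) < σ ω u)) ≤ _
  rw [expect_comm]
  refine expect_le (BlockCode.prob_nonneg ch ⟨θ, e, g, fun a => ⟨0, hL a.1⟩⟩ s w)
    (BlockCode.sum_prob ch ⟨θ, e, g, fun a => ⟨0, hL a.1⟩⟩ s w) fun ω => ?_
  rw [expect_sum]
  have hu : ∀ u : Fin n → 𝒴r i,
      expect (prodWeight fun (a : Σ i, Fin n → 𝒴r i) (_ : Fin (L a.1)) => (L a.1 : ℝ)⁻¹)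
        (fun b => ind (u ≠ m ω ∧ b ⟨i, u⟩ = b ⟨i, m ω⟩ ∧
          (2 : ℝ) ^ (n * t.indexExp i) < σ ω u)) ≤
      (L i : ℝ)⁻¹ * ((∏ _k : Fin n, 1) * ind ((2 : ℝ) ^ (n * t.indexExp i) < σ ω u)) := by
    intro u
    rw [Finset.prod_const_one, one_mul]
    by_cases hne : u = m ω
    · simp only [hne, ne_eq, not_true_eq_false, false_and]
      refine (Finset.sum_nonpos fun b _ => ?_).trans (mul_nonneg (by positivity) (ind_nonneg _))
      rw [ind_of_false not_false, mul_zero]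
    have hs : (⟨i, m ω⟩ : Σ i, Fin n → 𝒴r i) ≠ ⟨i, u⟩ := by
      intro h
      exact hne (by simpa using h.symm)
    -- the bin of a false sequence is independent of the bin of the true one
    have h := expect_prodWeight_resample (B := fun a : (Σ i, Fin n → 𝒴r i) => Fin (L a.1))
      (q := fun (a : Σ i, Fin n → 𝒴r i) (_ : Fin (L a.1)) => (L a.1 : ℝ)⁻¹) ⟨i, u⟩
      (sum_inv_card_fin (hL i))
      (fun b l => ind (u ≠ m ω ∧ l = b ⟨i, m ω⟩ ∧ (2 : ℝ) ^ (n * t.indexExp i) < σ ω u)) (by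
        intro b l v
        simp only [Function.update_of_ne hs])
    refine h.le.trans (expect_le (prodWeight_nonneg fun _ _ => by positivity)
      (sum_binsWeight hL) fun b => ?_)
    rw [expect, ← Finset.mul_sum]
    refine mul_le_mul_of_nonneg_left ?_ (by positivity)
    rw [Finset.sum_eq_single (b ⟨i, m ω⟩)]
    · exact ind_le (ind_nonneg _) fun h => (ind_of_true h.2.2).ge
    · exact fun l _ hl => ind_of_false fun h => hl h.2.1
    · simp
  refine (Finset.sum_le_sum fun u _ => hu u).trans ?_
  rw [← Finset.mul_sum]
  refine mul_le_mul_of_nonneg_left ?_ (by positivity)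
  exact sum_prod_mul_threshold_le (fun _ => 1) (fun _ => zero_le_one)
    (fun k u => t.index (θ k) i u ((fun i => g ⟨i, s i⟩ k, (ω k).1),
      fun j => maskOut y₀ (θ k) (ω k).2 j))
    (fun k u => ht.index_nonneg _ _ _ _) (fun k => by simpa using ht.index_sum _ _ _)
    (two_rpow_pos _)

end BlockError

section BlockErrorLimit

variable {N : ℕ} {𝒳 𝒴 : Type*} {𝒳r 𝒴r : Fin N → Type*}
  [Fintype 𝒳] [Fintype 𝒴] [∀ i, Fintype (𝒳r i)] [∀ i, Fintype (𝒴r i)]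
  {n M : ℕ} {L : Fin N → ℕ} {precX precY : Fin N → Fin N → Prop}

theorem joint_nonneg (ch : RelayChannel 𝒳 𝒴 𝒳r 𝒴r) {p : 𝒳 → ℝ} {pr : ∀ i, 𝒳r i → ℝ}
    (hp : p ∈ stdSimplex ℝ 𝒳) (hpr : ∀ i, pr i ∈ stdSimplex ℝ (𝒳r i))
    (ω : Outcome 𝒳 𝒴 𝒳r 𝒴r) : 0 ≤ ch.joint p pr ω :=
  mul_nonneg (mul_nonneg (hp.1 _) (Finset.prod_nonneg fun i _ => (hpr i).1 _))
    ((ch.prob_mem _ _).1 _)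

/-- A sum over the outcomes in which the summand depends only on the inputs. -/
theorem sum_joint_mul_inputs (ch : RelayChannel 𝒳 𝒴 𝒳r 𝒴r) (p : 𝒳 → ℝ) (pr : ∀ i, 𝒳r i → ℝ)
    (f : 𝒳 → (∀ i, 𝒳r i) → ℝ) :
    ∑ ω, ch.joint p pr ω * f (srcIn ω) (relayIns ω) =
      ∑ x, p x * ∑ xr : ∀ i, 𝒳r i, prodWeight pr xr * f x xr := by
  rw [Fintype.sum_prod_type]
  refine Finset.sum_congr rfl fun x _ => ?_
  rw [Fintype.sum_prod_type, Finset.mul_sum]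
  refine Finset.sum_congr rfl fun xr _ => ?_
  have : ∀ yy, ch.joint p pr (x, xr, yy) * f (srcIn (x, xr, yy)) (relayIns (x, xr, yy)) =
      p x * (prodWeight pr xr * f x xr) * ch.prob x xr yy := by
    intro yy
    simp only [RelayChannel.joint, srcIn, relayIns, relayIn, prodWeight]
    ring
  simp_rw [this, ← Finset.mul_sum]
  rw [(ch.prob_mem x xr).2, mul_one]

theorem sum_joint (ch : RelayChannel 𝒳 𝒴 𝒳r 𝒴r) {p : 𝒳 → ℝ} {pr : ∀ i, 𝒳r i → ℝ}
    (hp : p ∈ stdSimplex ℝ 𝒳) (hpr : ∀ i, pr i ∈ stdSimplex ℝ (𝒳r i)) :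
    ∑ ω, ch.joint p pr ω = 1 := by
  have h := sum_joint_mul_inputs ch p pr fun _ _ => 1
  simpa only [mul_one, sum_prodWeight fun i => (hpr i).2, hp.2] using h

namespace Tests

variable (t : Tests 𝒳 𝒴 𝒳r 𝒴r precX precY) (y₀ : ∀ i, 𝒴r i)

/-- The score of the true input of relay `i` at one time. -/
noncomputable def relayVar (i : Fin N) (o : Finset (Fin N) × Outcome 𝒳 𝒴 𝒳r 𝒴r) : ℝ :=
  t.relay i (relayIn i o.2) (dstOut o.2, relayInsOn (before precX i) o.2)

/-- The score of the true masked output of relay `i` at one time. -/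
def indexVar (i : Fin N) (o : Finset (Fin N) × Outcome 𝒳 𝒴 𝒳r 𝒴r) : ℝ :=
  t.index o.1 i (maskOut y₀ o.1 o.2.2.2.2 i)
    (insAndOut o.2, fun j => maskOut y₀ o.1 o.2.2.2.2 j)

/-- The score of the true input of the source at one time. -/
def sourceVar (o : Finset (Fin N) × Outcome 𝒳 𝒴 𝒳r 𝒴r) : ℝ :=
  t.source o.1 (srcIn o.2) (insAndOut o.2, maskOut y₀ o.1 o.2.2.2.2)

/-- The exponents are below the expected logarithms of the scores. -/
structure Reliable (P : Finset (Fin N) × Outcome 𝒳 𝒴 𝒳r 𝒴r → ℝ) : Prop where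
  relay_pos : ∀ i o, P o ≠ 0 → 0 < t.relayVar i o
  relay_lt : ∀ i, t.relayExp i < ∑ o, P o * Real.logb 2 (t.relayVar i o)
  index_pos : ∀ i o, P o ≠ 0 → 0 < t.indexVar y₀ i o
  index_lt : ∀ i, t.indexExp i < ∑ o, P o * Real.logb 2 (t.indexVar y₀ i o)
  source_pos : ∀ o, P o ≠ 0 → 0 < t.sourceVar y₀ o
  source_lt : t.sourceExp < ∑ o, P o * Real.logb 2 (t.sourceVar y₀ o)

end Tests

variable {q : Fin N → ℝ} {p : 𝒳 → ℝ} {pr : ∀ i, 𝒳r i → ℝ} {y₀ : ∀ i, 𝒴r i}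
  {t : Tests 𝒳 𝒴 𝒳r 𝒴r precX precY} (ch : RelayChannel 𝒳 𝒴 𝒳r 𝒴r)
  (hq : ∀ i, 0 ≤ q i ∧ q i ≤ 1) (hp : p ∈ stdSimplex ℝ 𝒳)
  (hpr : ∀ i, pr i ∈ stdSimplex ℝ (𝒳r i)) (hL : ∀ i, 0 < L i)

include hq hp hpr in
theorem maskedJoint_nonneg (o) : 0 ≤ maskedJoint ch q p pr o :=
  mul_nonneg (subsetProb_univ_nonneg hq _) (joint_nonneg ch hp hpr _)

include hp hpr in
theorem sum_maskedJoint : ∑ o, maskedJoint ch q p pr o = 1 := by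
  rw [Fintype.sum_prod_type, ← sum_subsetProb_univ q]
  refine Finset.sum_congr rfl fun θ _ => ?_
  simp only [maskedJoint]
  rw [← Finset.mul_sum, sum_joint ch hp hpr, mul_one]

include hq hp hpr in
/-- The probability that one of the true words and masked outputs fails its test decreases
exponentially. -/
theorem exists_codeExpect_fail_le (ht : t.Reliable y₀ (maskedJoint ch q p pr)) :
    ∃ (a₁ a₂ : Fin N → ℝ) (a₃ : ℝ), (∀ i, 0 ≤ a₁ i ∧ a₁ i < 1) ∧ (∀ i, 0 ≤ a₂ i ∧ a₂ i < 1) ∧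
      (0 ≤ a₃ ∧ a₃ < 1) ∧
      ∀ (n M : ℕ) (L : Fin N → ℕ) (_ : ∀ i, 0 < L i) (s : ∀ i, Fin (L i)) (w : Fin M),
        (∀ i, codeExpect q p pr (fun D : BlockCode 𝒳 𝒳r 𝒴r n M L =>
          expect (D.prob ch s w) fun ω =>
            ind (t.relayScore D s ω i (D.word ⟨i, s i⟩) ≤ (2 : ℝ) ^ (n * t.relayExp i))) ≤
              a₁ i ^ n) ∧
        (∀ i, codeExpect q p pr (fun D : BlockCode 𝒳 𝒳r 𝒴r n M L =>
          expect (D.prob ch s w) fun ω =>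
            ind (t.indexScore y₀ D s ω i (D.masked y₀ ω i) ≤ (2 : ℝ) ^ (n * t.indexExp i))) ≤
              a₂ i ^ n) ∧
        codeExpect q p pr (fun D : BlockCode 𝒳 𝒳r 𝒴r n M L =>
          expect (D.prob ch s w) fun ω =>
            ind (t.sourceScore y₀ D s ω (D.enc w) ≤ (2 : ℝ) ^ (n * t.sourceExp))) ≤ a₃ ^ n := by
  have hP0 := maskedJoint_nonneg (q := q) ch hq hp hpr
  have hP1 := sum_maskedJoint (q := q) ch hp hpr
  choose a₁ h10 h11 h1 using fun i =>
    exists_sum_prod_mul_le_pow _ hP0 hP1 (t.relayVar i) (ht.relay_pos i) (ht.relay_lt i)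
  choose a₂ h20 h21 h2 using fun i =>
    exists_sum_prod_mul_le_pow _ hP0 hP1 (t.indexVar y₀ i) (ht.index_pos i) (ht.index_lt i)
  obtain ⟨a₃, h30, h31, h3⟩ :=
    exists_sum_prod_mul_le_pow _ hP0 hP1 (t.sourceVar y₀) ht.source_pos ht.source_lt
  refine ⟨a₁, a₂, a₃, fun i => ⟨h10 i, h11 i⟩, fun i => ⟨h20 i, h21 i⟩, ⟨h30, h31⟩,
    fun n M L hL s w => ⟨fun i => ?_, fun i => ?_, ?_⟩⟩
  · refine (codeExpect_expect_prob hp hpr ch hL s w fun _ _ xr ω =>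
      ind (∏ k, t.relay i (xr i k) ((ω k).1, fun j => xr j k) ≤
        (2 : ℝ) ^ (n * t.relayExp i))).le.trans (h1 i n)
  · refine (codeExpect_expect_prob hp hpr ch hL s w fun θ _ xr ω =>
      ind (∏ k, t.index (θ k) i (maskOut y₀ (θ k) (ω k).2 i)
        ((fun i => xr i k, (ω k).1), fun j => maskOut y₀ (θ k) (ω k).2 j) ≤
        (2 : ℝ) ^ (n * t.indexExp i))).le.trans (h2 i n)
  · refine (codeExpect_expect_prob hp hpr ch hL s w fun θ x xr ω =>
      ind (∏ k, t.source (θ k) (x k)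
        ((fun i => xr i k, (ω k).1), maskOut y₀ (θ k) (ω k).2) ≤
        (2 : ℝ) ^ (n * t.sourceExp))).le.trans (h3 n)

end BlockErrorLimit

/-- The union bound for the failure of one of the conditions in `Tests.Good`. -/
theorem ind_not_good_le {N : ℕ} {𝒳 𝒴 : Type*} {𝒳r 𝒴r : Fin N → Type*} [∀ i, Fintype (𝒴r i)]
    {n M : ℕ} {L : Fin N → ℕ} {precX precY : Fin N → Fin N → Prop}
    {t : Tests 𝒳 𝒴 𝒳r 𝒴r precX precY} {y₀ : ∀ i, 𝒴r i}
    (D : BlockCode 𝒳 𝒳r 𝒴r n M L) (s : ∀ i, Fin (L i)) (w : Fin M)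
    (ω : Fin n → 𝒴 × (∀ i, 𝒴r i)) :
    ind (¬t.Good y₀ D s ω w) ≤
      (∑ i, ind (t.relayScore D s ω i (D.word ⟨i, s i⟩) ≤ (2 : ℝ) ^ (n * t.relayExp i))) +
      (∑ i, ∑ s', ind (s' ≠ s i ∧
        (2 : ℝ) ^ (n * t.relayExp i) < t.relayScore D s ω i (D.word ⟨i, s'⟩))) +
      (∑ i, ind (t.indexScore y₀ D s ω i (D.masked y₀ ω i) ≤ (2 : ℝ) ^ (n * t.indexExp i))) +
      (∑ i, ∑ u, ind (u ≠ D.masked y₀ ω i ∧ D.bin ⟨i, u⟩ = D.bin ⟨i, D.masked y₀ ω i⟩ ∧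
        (2 : ℝ) ^ (n * t.indexExp i) < t.indexScore y₀ D s ω i u)) +
      ind (t.sourceScore y₀ D s ω (D.enc w) ≤ (2 : ℝ) ^ (n * t.sourceExp)) +
      ∑ w', ind (w' ≠ w ∧
        (2 : ℝ) ^ (n * t.sourceExp) < t.sourceScore y₀ D s ω (D.enc w')) := by
  refine le_trans (ind_mono ?_) (ind_or_le (ind_or_le (ind_or_le (ind_or_le (ind_or_le
    (ind_exists_le fun i => le_rfl)
    (ind_exists_le fun i => ind_exists_le fun s' => le_rfl))
    (ind_exists_le fun i => le_rfl))
    (ind_exists_le fun i => ind_exists_le fun u => le_rfl))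
    le_rfl)
    (ind_exists_le fun w' => le_rfl))
  intro hbad
  by_contra hno
  simp only [not_or, not_exists, not_and, not_le, not_lt] at hno
  obtain ⟨⟨⟨⟨⟨h1, h2⟩, h3⟩, h4⟩, h5⟩, h6⟩ := hno
  exact hbad
    { relay_pass := h1
      relay_unique := fun i s' hlt => by_contra fun hne => (h2 i s' hne).not_gt hlt
      index_pass := h3
      index_unique := fun i u hb hlt => by_contra fun hne => (h4 i u hne hb).not_gt hlt
      source_pass := h5
      source_unique := fun w' hlt => by_contra fun hne => (h6 w' hne).not_gt hlt }

section BlockCodeExistence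

variable {N : ℕ} {𝒳 𝒴 : Type*} {𝒳r 𝒴r : Fin N → Type*}
  [Fintype 𝒳] [Fintype 𝒴] [∀ i, Fintype (𝒳r i)] [∀ i, Fintype (𝒴r i)]
  {n M : ℕ} {L : Fin N → ℕ} {precX precY : Fin N → Fin N → Prop}

theorem ceil_two_rpow_le (n : ℕ) {R : ℝ} (hR : 0 ≤ R) :
    (⌈(2 : ℝ) ^ (n * R)⌉₊ : ℝ) ≤ 2 * (2 : ℝ) ^ (n * R) := by
  have h1 : (1 : ℝ) ≤ 2 ^ (n * R) := Real.one_le_rpow one_le_two (by positivity)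
  have h2 := Nat.ceil_lt_add_one (two_rpow_pos (n * R)).le
  linarith

theorem two_rpow_mul_inv (n : ℕ) (R τ : ℝ) :
    (2 : ℝ) ^ (n * R) * ((2 : ℝ) ^ (n * τ))⁻¹ = ((2 : ℝ) ^ (R - τ)) ^ n := by
  rw [← Real.rpow_neg two_pos.le, ← Real.rpow_add two_pos, ← Real.rpow_mul_natCast two_pos.le]
  congr 1
  ring

theorem tendsto_two_rpow_pow {x : ℝ} (hx : x < 0) :
    Tendsto (fun n : ℕ => ((2 : ℝ) ^ x) ^ n) atTop (𝓝 0) :=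
  tendsto_pow_atTop_nhds_zero_of_lt_one (two_rpow_pos x).le
    (Real.rpow_lt_one_of_one_lt_of_neg one_lt_two hx)

/-- The number of words of each relay in a block of length `n`, for the rates `Rr`; a relay that is
never in the mask has only one word. -/
noncomputable def relayCard (q : Fin N → ℝ) (Rr : Fin N → ℝ) (n : ℕ) (i : Fin N) : ℕ :=
  if q i = 0 then 1 else ⌈(2 : ℝ) ^ (n * Rr i)⌉₊

theorem relayCard_pos (q : Fin N → ℝ) (Rr : Fin N → ℝ) (n : ℕ) (i : Fin N) :
    0 < relayCard q Rr n i := by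
  rw [relayCard]
  split_ifs
  · exact one_pos
  · exact Nat.ceil_pos.2 (two_rpow_pos _)

variable {q : Fin N → ℝ} {p : 𝒳 → ℝ} {pr : ∀ i, 𝒳r i → ℝ} {y₀ : ∀ i, 𝒴r i}
  {t : Tests 𝒳 𝒴 𝒳r 𝒴r precX precY} (ch : RelayChannel 𝒳 𝒴 𝒳r 𝒴r)

/-- If the rates of the source and of the relays are below the exponents of their tests, and the
rates of the relays exceed the negative exponents of the tests for the masked outputs, then the
average error probability of a random code for one block tends to `0`, uniformly in the message and
the relay indices. -/
theorem exists_tendsto_codeExpect_le (hq : ∀ i, 0 ≤ q i ∧ q i ≤ 1) (hp : p ∈ stdSimplex ℝ 𝒳)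
    (hpr : ∀ i, pr i ∈ stdSimplex ℝ (𝒳r i)) (ht : t.Normalized p pr y₀)
    (hr : t.Reliable y₀ (maskedJoint ch q p pr)) {Rr : Fin N → ℝ} {R : ℝ} (hR : 0 ≤ R)
    (hRt : R < t.sourceExp)
    (hRr : ∀ i, q i ≠ 0 → 0 ≤ Rr i ∧ Rr i < t.relayExp i ∧ -Rr i < t.indexExp i) :
    ∃ ε : ℕ → ℝ, Tendsto ε atTop (𝓝 0) ∧ ∀ (n : ℕ) (s : ∀ i, Fin (relayCard q Rr n i))
      (w : Fin ⌈(2 : ℝ) ^ (n * R)⌉₊),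
      codeExpect q p pr (fun D : BlockCode 𝒳 𝒳r 𝒴r n ⌈(2 : ℝ) ^ (n * R)⌉₊ (relayCard q Rr n) =>
        expect (D.prob ch s w) fun ω => ind (¬t.Good y₀ D s ω w)) ≤ ε n := by
  obtain ⟨a₁, a₂, a₃, ha₁, ha₂, ha₃, hfail⟩ := exists_codeExpect_fail_le ch hq hp hpr hr
  refine ⟨fun n => (∑ i, a₁ i ^ n) +
    (∑ i, if q i = 0 then 0 else 2 * ((2 : ℝ) ^ (Rr i - t.relayExp i)) ^ n) +
    (∑ i, a₂ i ^ n) +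
    (∑ i, if q i = 0 then 0 else ((2 : ℝ) ^ (-Rr i - t.indexExp i)) ^ n) +
    a₃ ^ n + 2 * ((2 : ℝ) ^ (R - t.sourceExp)) ^ n, ?_, fun n s w => ?_⟩
  · have h0 : 𝓝 (0 : ℝ) = 𝓝 ((∑ _i : Fin N, 0) + (∑ _i : Fin N, 0) + (∑ _i : Fin N, 0) +
        (∑ _i : Fin N, 0) + 0 + 2 * 0) := by simp
    rw [h0]
    refine ((((Tendsto.add ?_ ?_).add ?_).add ?_).add ?_).add ?_
    · exact tendsto_finsetSum _ fun i _ =>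
        tendsto_pow_atTop_nhds_zero_of_lt_one (ha₁ i).1 (ha₁ i).2
    · refine tendsto_finsetSum _ fun i _ => ?_
      split_ifs with hqi
      · exact tendsto_const_nhds
      · simpa using (tendsto_two_rpow_pow (sub_neg.2 (hRr i hqi).2.1)).const_mul 2
    · exact tendsto_finsetSum _ fun i _ =>
        tendsto_pow_atTop_nhds_zero_of_lt_one (ha₂ i).1 (ha₂ i).2
    · refine tendsto_finsetSum _ fun i _ => ?_
      split_ifs with hqi
      · exact tendsto_const_nhds
      · exact tendsto_two_rpow_pow (sub_neg.2 (hRr i hqi).2.2)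
    · exact tendsto_pow_atTop_nhds_zero_of_lt_one ha₃.1 ha₃.2
    · exact (tendsto_two_rpow_pow (sub_neg.2 hRt)).const_mul 2
  have hL := relayCard_pos q Rr n
  obtain ⟨h1, h3, h5⟩ := hfail n _ _ hL s w
  refine (codeExpect_mono hq hp hpr fun D => expect_mono (D.prob_nonneg ch s w)
    fun ω => ind_not_good_le D s w ω).trans ?_
  simp only [expect_add, codeExpect_add]
  refine add_le_add (add_le_add (add_le_add (add_le_add (add_le_add ?_ ?_) ?_) ?_) h5) ?_
  · simp only [expect_sum, codeExpect_sum]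
    exact Finset.sum_le_sum fun i _ => h1 i
  · simp only [expect_sum, codeExpect_sum]
    refine Finset.sum_le_sum fun i _ => ?_
    refine (Finset.sum_le_sum fun s' _ =>
      codeExpect_relay_false_le ch hq hp hpr hL ht s w i s').trans ?_
    split_ifs with hqi
    · -- there is only one word, hence no false one
      refine (Finset.sum_eq_zero fun s' _ => if_pos ?_).le
      have h1 : relayCard q Rr n i = 1 := if_pos hqi
      exact Fin.ext (by have := s'.2; have := (s i).2; omega)
    · calc _ ≤ ∑ s' : Fin (relayCard q Rr n i), ((2 : ℝ) ^ (n * t.relayExp i))⁻¹ := by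
            refine Finset.sum_le_sum fun s' _ => ?_
            have := (two_rpow_pos (n * t.relayExp i)).le
            split_ifs
            · positivity
            · exact le_rfl
        _ = (⌈(2 : ℝ) ^ (n * Rr i)⌉₊ : ℝ) * ((2 : ℝ) ^ (n * t.relayExp i))⁻¹ := by
            rw [Finset.sum_const, card_univ, Fintype.card_fin, nsmul_eq_mul, relayCard,
              if_neg hqi]
        _ ≤ 2 * (2 : ℝ) ^ (n * Rr i) * ((2 : ℝ) ^ (n * t.relayExp i))⁻¹ :=
            mul_le_mul_of_nonneg_right (ceil_two_rpow_le n (hRr i hqi).1)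
              (inv_nonneg.2 (two_rpow_pos _).le)
        _ = _ := by rw [mul_assoc, two_rpow_mul_inv]
  · simp only [expect_sum, codeExpect_sum]
    exact Finset.sum_le_sum fun i _ => h3 i
  · rw [show (fun D : BlockCode 𝒳 𝒳r 𝒴r n ⌈(2 : ℝ) ^ (n * R)⌉₊ (relayCard q Rr n) =>
      expect (D.prob ch s w) fun ω => ∑ i, ∑ u, ind (u ≠ D.masked y₀ ω i ∧
        D.bin ⟨i, u⟩ = D.bin ⟨i, D.masked y₀ ω i⟩ ∧
        (2 : ℝ) ^ (n * t.indexExp i) < t.indexScore y₀ D s ω i u)) = fun D => ∑ i,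
      expect (D.prob ch s w) fun ω => ∑ u, ind (u ≠ D.masked y₀ ω i ∧
        D.bin ⟨i, u⟩ = D.bin ⟨i, D.masked y₀ ω i⟩ ∧
        (2 : ℝ) ^ (n * t.indexExp i) < t.indexScore y₀ D s ω i u) from
      funext fun D => expect_sum _ _ _, codeExpect_sum]
    refine Finset.sum_le_sum fun i _ => ?_
    refine (codeExpect_index_false_le ch hq hp hpr hL ht s w i).trans ?_
    split_ifs with hqi
    · exact le_rfl
    · rw [← two_rpow_mul_inv, relayCard, if_neg hqi, mul_neg, Real.rpow_neg two_pos.le]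
      refine mul_le_mul_of_nonneg_right ?_ (inv_nonneg.2 (two_rpow_pos _).le)
      exact inv_anti₀ (two_rpow_pos _) (Nat.le_ceil _)
  · simp only [expect_sum, codeExpect_sum]
    refine (Finset.sum_le_sum fun w' _ =>
      codeExpect_source_false_le ch hq hp hpr hL ht s w w').trans ?_
    rw [Finset.sum_const, card_univ, Fintype.card_fin, nsmul_eq_mul, ← two_rpow_mul_inv,
      ← mul_assoc]
    exact mul_le_mul_of_nonneg_right (ceil_two_rpow_le n hR) (inv_nonneg.2 (two_rpow_pos _).le)

/-- One code for a block that is good on average for given weights of the relay indices and the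
messages. -/
theorem exists_blockCode_le (hq : ∀ i, 0 ≤ q i ∧ q i ≤ 1) (hp : p ∈ stdSimplex ℝ 𝒳)
    (hpr : ∀ i, pr i ∈ stdSimplex ℝ (𝒳r i)) (hL : ∀ i, 0 < L i) {ε : ℝ}
    (hε : ∀ (s : ∀ i, Fin (L i)) (w : Fin M),
      codeExpect q p pr (fun D : BlockCode 𝒳 𝒳r 𝒴r n M L =>
        expect (D.prob ch s w) fun ω => ind (¬t.Good y₀ D s ω w)) ≤ ε)
    {I : Type*} [Fintype I] (μ : I → ℝ) (hμ : ∀ x, 0 ≤ μ x) (s : I → ∀ i, Fin (L i))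
    (w : I → Fin M) :
    ∃ D : BlockCode 𝒳 𝒳r 𝒴r n M L, ∑ x, μ x * expect (D.prob ch (s x) (w x))
      (fun ω => ind (¬t.Good y₀ D (s x) ω (w x))) ≤ ε * ∑ x, μ x := by
  refine exists_le_of_codeExpect_le hq hp hpr hL ?_
  rw [codeExpect_sum, Finset.mul_sum]
  refine Finset.sum_le_sum fun x _ => ?_
  rw [codeExpect_mul_left, mul_comm]
  exact mul_le_mul_of_nonneg_right (hε _ _) (hμ x)

end BlockCodeExistence

/-! ### Concatenation of blocks -/

section Chain

variable {N : ℕ} {𝒳 𝒴 : Type*} {𝒳r 𝒴r : Fin N → Type*}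

/-- The code that first uses `c` and then `r` further symbols; in this second part the source sends
`e w` and relay `i` sends a word that depends on its outputs during the first part. -/
def RelayCode.append {K m r : ℕ} (c : RelayCode 𝒳 𝒴 𝒳r 𝒴r K m) (e : Fin K → Fin r → 𝒳)
    (rel : ∀ i, (Fin m → 𝒴r i) → Fin r → 𝒳r i) : RelayCode 𝒳 𝒴 𝒳r 𝒴r K (m + r) where
  enc w := Fin.append (c.enc w) (e w)
  relay i k f := if h : (k : ℕ) < m then c.relay i ⟨k, h⟩ f
    else rel i (fun j => f ⟨j, j.2.trans_le (not_lt.1 h)⟩) ⟨k - m, by omega⟩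
  dec y := c.dec fun k => y (Fin.castAdd r k)

variable [Fintype 𝒴] [∀ i, Fintype (𝒴r i)] (ch : RelayChannel 𝒳 𝒴 𝒳r 𝒴r)

theorem RelayChannel.blockProb_nonneg {K m : ℕ} (c : RelayCode 𝒳 𝒴 𝒳r 𝒴r K m) (w : Fin K)
    (ω : Fin m → 𝒴 × (∀ i, 𝒴r i)) : 0 ≤ ch.blockProb c w ω :=
  Finset.prod_nonneg fun _ _ => (ch.prob_mem _ _).1 _

theorem RelayChannel.errorProb_nonneg {K m : ℕ} (c : RelayCode 𝒳 𝒴 𝒳r 𝒴r K m) :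
    0 ≤ ch.errorProb c :=
  div_nonneg (Finset.sum_nonneg fun w _ => Finset.sum_nonneg fun ω _ => by
    split_ifs
    · exact ch.blockProb_nonneg c w ω
    · exact le_rfl) (Nat.cast_nonneg _)

theorem RelayChannel.blockProb_append {K m r : ℕ} (c : RelayCode 𝒳 𝒴 𝒳r 𝒴r K m)
    (e : Fin K → Fin r → 𝒳) (rel : ∀ i, (Fin m → 𝒴r i) → Fin r → 𝒳r i) (w : Fin K)
    (ω : Fin m → 𝒴 × (∀ i, 𝒴r i)) (ω' : Fin r → 𝒴 × (∀ i, 𝒴r i)) :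
    ch.blockProb (c.append e rel) w (Fin.append ω ω') =
      ch.blockProb c w ω *
        ∏ k, ch.prob (e w k) (fun i => rel i (fun j => (ω j).2 i) k) (ω' k) := by
  have hω : ∀ (j : ℕ) (hj : j < m) (hj' : j < m + r), Fin.append ω ω' ⟨j, hj'⟩ = ω ⟨j, hj⟩ :=
    fun j hj hj' => Fin.append_left ω ω' ⟨j, hj⟩
  rw [RelayChannel.blockProb, Fin.prod_univ_add]
  congr 1
  · refine Finset.prod_congr rfl fun k _ => ?_
    rw [Fin.append_left]
    congr 1
    · exact Fin.append_left _ _ k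
    · funext i
      simp only [RelayCode.relayInput, RelayCode.append, Fin.val_castAdd, k.2, dite_true]
      congr 1
      funext j
      rw [hω j (j.2.trans k.2)]
  · refine Finset.prod_congr rfl fun k _ => ?_
    rw [Fin.append_right]
    congr 1
    · exact Fin.append_right _ _ k
    · funext i
      have hk : ¬ m + (k : ℕ) < m := by omega
      simp only [RelayCode.relayInput, RelayCode.append, Fin.val_natAdd, hk, dite_false,
        Nat.add_sub_cancel_left]
      congr 1
      funext j
      rw [hω j j.2]

theorem RelayChannel.sum_blockProb_append_mul {K m r : ℕ} (c : RelayCode 𝒳 𝒴 𝒳r 𝒴r K m)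
    (e : Fin K → Fin r → 𝒳) (rel : ∀ i, (Fin m → 𝒴r i) → Fin r → 𝒳r i) (w : Fin K)
    (f : (Fin (m + r) → 𝒴 × (∀ i, 𝒴r i)) → ℝ) :
    ∑ ω, ch.blockProb (c.append e rel) w ω * f ω =
      ∑ ω, ch.blockProb c w ω * expect (fun ω' : Fin r → 𝒴 × (∀ i, 𝒴r i) =>
        ∏ k, ch.prob (e w k) (fun i => rel i (fun j => (ω j).2 i) k) (ω' k))
        fun ω' => f (Fin.append ω ω') := by
  rw [← Fintype.sum_equiv (Fin.appendEquiv m r) (fun x => _) _ fun x => rfl, Fintype.sum_prod_type]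
  refine Finset.sum_congr rfl fun ω _ => ?_
  rw [expect, Finset.mul_sum]
  refine Finset.sum_congr rfl fun ω' _ => ?_
  change ch.blockProb (c.append e rel) w (Fin.append ω ω') * f (Fin.append ω ω') = _
  rw [ch.blockProb_append]
  ring

theorem RelayChannel.sum_prob_word {K m r : ℕ} (e : Fin K → Fin r → 𝒳)
    (rel : ∀ i, (Fin m → 𝒴r i) → Fin r → 𝒳r i) (w : Fin K) (ω : Fin m → 𝒴 × (∀ i, 𝒴r i)) :
    ∑ ω' : Fin r → 𝒴 × (∀ i, 𝒴r i),
      ∏ k, ch.prob (e w k) (fun i => rel i (fun j => (ω j).2 i) k) (ω' k) = 1 :=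
  sum_prod_apply_eq_one fun _ => (ch.prob_mem _ _).2

/-- The code `c` transmits the digits `φ w 0, …, φ w (b - 1)` of the message `w`: in the good cases
`G`, which fail with total weight at most `δ`, these digits are determined by the outputs at the
destination, together with the indices `σ i` that the relays still have to transmit. -/
structure TransmitsDigits {K m M : ℕ} {L : Fin N → ℕ} (c : RelayCode 𝒳 𝒴 𝒳r 𝒴r K m)
    (σ : ∀ i, (Fin m → 𝒴r i) → Fin (L i)) (G : Fin K → (Fin m → 𝒴 × (∀ i, 𝒴r i)) → Prop)
    (φ : Fin K → ℕ → Fin M) (b : ℕ) (δ : ℝ) : Prop where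
  sum_eq : ∀ w, ∑ ω, ch.blockProb c w ω = 1
  fail_le : ∑ w, ∑ ω, ch.blockProb c w ω * ind (¬G w ω) ≤ δ
  digit_eq : ∀ w w' ω ω', G w ω → G w' ω' → (∀ k, (ω k).1 = (ω' k).1) →
    (∀ i, σ i (fun k => (ω k).2 i) = σ i (fun k => (ω' k).2 i)) → ∀ j < b, φ w j = φ w' j

variable {ch} {precX precY : Fin N → Fin N → Prop} [IsStrictOrder (Fin N) precX]
  [IsStrictOrder (Fin N) precY] {t : Tests 𝒳 𝒴 𝒳r 𝒴r precX precY} {y₀ : ∀ i, 𝒴r i}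

/-- One more block transmits one more digit, together with the indices for the preceding block. -/
theorem TransmitsDigits.append {K m M n : ℕ} {L : Fin N → ℕ} {c : RelayCode 𝒳 𝒴 𝒳r 𝒴r K m}
    {σ : ∀ i, (Fin m → 𝒴r i) → Fin (L i)} {G : Fin K → (Fin m → 𝒴 × (∀ i, 𝒴r i)) → Prop}
    {φ : Fin K → ℕ → Fin M} {b : ℕ} {δ ε : ℝ} (h : TransmitsDigits ch c σ G φ b δ)
    (hblock : ∀ (μ : Fin K × (Fin m → 𝒴 × (∀ i, 𝒴r i)) → ℝ) (_ : ∀ x, 0 ≤ μ x)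
      (s : Fin K × (Fin m → 𝒴 × (∀ i, 𝒴r i)) → ∀ i, Fin (L i))
      (w : Fin K × (Fin m → 𝒴 × (∀ i, 𝒴r i)) → Fin M),
      ∃ D : BlockCode 𝒳 𝒳r 𝒴r n M L, ∑ x, μ x * expect (D.prob ch (s x) (w x))
        (fun ω => ind (¬t.Good y₀ D (s x) ω (w x))) ≤ ε * ∑ x, μ x) :
    ∃ (c' : RelayCode 𝒳 𝒴 𝒳r 𝒴r K (m + n)) (σ' : ∀ i, (Fin (m + n) → 𝒴r i) → Fin (L i))
      (G' : Fin K → (Fin (m + n) → 𝒴 × (∀ i, 𝒴r i)) → Prop),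
      TransmitsDigits ch c' σ' G' φ (b + 1) (δ + ε * K) ∧
      ∀ w w' ω ω', G' w ω → G' w' ω' → (∀ k, (ω k).1 = (ω' k).1) → ∀ j < b, φ w j = φ w' j := by
  -- a code for the new block that is good for the weights that `c` induces on the indices
  obtain ⟨D, hD⟩ := hblock (fun x => ch.blockProb c x.1 x.2) (fun x => ch.blockProb_nonneg c _ _)
    (fun x i => σ i fun k => (x.2 k).2 i) (fun x => φ x.1 b)
  set S : (Fin m → 𝒴 × (∀ i, 𝒴r i)) → ∀ i, Fin (L i) := fun ω i => σ i fun k => (ω k).2 i with hS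
  set G' : Fin K → (Fin (m + n) → 𝒴 × (∀ i, 𝒴r i)) → Prop := fun w ω =>
    G w (fun k => ω (Fin.castAdd n k)) ∧
      t.Good y₀ D (S fun k => ω (Fin.castAdd n k)) (fun k => ω (Fin.natAdd m k)) (φ w b) with hG'
  have hSeq : ∀ w w' ω ω', G' w ω → G' w' ω' → (∀ k, (ω k).1 = (ω' k).1) →
      S (fun k => ω (Fin.castAdd n k)) = S (fun k => ω' (Fin.castAdd n k)) :=
    fun w w' ω ω' hg hg' hy => hg.2.relay_eq hg'.2 fun k => hy _
  have hdig : ∀ w w' ω ω', G' w ω → G' w' ω' → (∀ k, (ω k).1 = (ω' k).1) →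
      ∀ j < b, φ w j = φ w' j := fun w w' ω ω' hg hg' hy =>
    h.digit_eq w w' _ _ hg.1 hg'.1 (fun k => hy _) fun i => congrFun (hSeq w w' ω ω' hg hg' hy) i
  set e : Fin K → Fin n → 𝒳 := fun w => D.enc (φ w b) with he
  set rel : ∀ i, (Fin m → 𝒴r i) → Fin n → 𝒳r i := fun i y => D.word ⟨i, σ i y⟩ with hrel
  refine ⟨c.append e rel, fun i y => D.index y₀ i fun k => y (Fin.natAdd m k), G', ⟨?_, ?_, ?_⟩,
    hdig⟩
  · intro w
    have h1 := ch.sum_blockProb_append_mul c e rel w fun _ => 1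
    simp only [mul_one] at h1
    rw [h1]
    refine (Finset.sum_congr rfl fun ω _ => ?_).trans (h.sum_eq w)
    rw [expect_const (ch.sum_prob_word e rel w ω), mul_one]
  · have h1 : ∀ w ω, expect (fun ω' : Fin n → 𝒴 × (∀ i, 𝒴r i) =>
        ∏ k, ch.prob (e w k) (fun i => rel i (fun j => (ω j).2 i) k) (ω' k))
        (fun ω' => ind (¬G' w (Fin.append ω ω'))) ≤
        ind (¬G w ω) + expect (D.prob ch (S ω) (φ w b))
          (fun ω' => ind (¬t.Good y₀ D (S ω) ω' (φ w b))) := by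
      intro w ω
      rw [← expect_const (D.sum_prob ch (S ω) (φ w b)) (ind (¬G w ω)), ← expect_add]
      refine expect_mono (D.prob_nonneg ch (S ω) (φ w b)) fun ω' => ?_
      refine (ind_mono ?_).trans (ind_or_le le_rfl le_rfl)
      simp only [hG', Fin.append_left, Fin.append_right]
      exact not_and_or.1
    calc ∑ w, ∑ ω, ch.blockProb (c.append e rel) w ω * ind (¬G' w ω)
        ≤ ∑ w, ∑ ω, ch.blockProb c w ω * (ind (¬G w ω) + expect (D.prob ch (S ω) (φ w b))
          (fun ω' => ind (¬t.Good y₀ D (S ω) ω' (φ w b)))) := by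
          refine Finset.sum_le_sum fun w _ => ?_
          rw [ch.sum_blockProb_append_mul]
          exact Finset.sum_le_sum fun ω _ =>
            mul_le_mul_of_nonneg_left (h1 w ω) (ch.blockProb_nonneg c w ω)
      _ ≤ δ + ε * K := by
          simp_rw [mul_add, Finset.sum_add_distrib]
          refine add_le_add h.fail_le ?_
          rw [Fintype.sum_prod_type, Fintype.sum_prod_type] at hD
          refine hD.trans_eq ?_
          simp [h.sum_eq]
  · intro w w' ω ω' hg hg' hy hσ j hj
    rcases Nat.lt_succ_iff_lt_or_eq.1 hj with hj | rfl
    · exact hdig w w' ω ω' hg hg' hy j hj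
    · have h2 := hg'.2
      rw [← hSeq w w' ω ω' hg hg' hy] at h2
      exact hg.2.source_eq h2 (fun k => hy _) hσ

/-- A chain of blocks transmits the digits of the message. -/
theorem exists_transmitsDigits {K M n : ℕ} {L : Fin N → ℕ} (hL : ∀ i, 0 < L i) (hK : 0 < K)
    {φ : Fin K → ℕ → Fin M} {ε : ℝ}
    (hblock : ∀ (m : ℕ) (μ : Fin K × (Fin m → 𝒴 × (∀ i, 𝒴r i)) → ℝ) (_ : ∀ x, 0 ≤ μ x)
      (s : Fin K × (Fin m → 𝒴 × (∀ i, 𝒴r i)) → ∀ i, Fin (L i))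
      (w : Fin K × (Fin m → 𝒴 × (∀ i, 𝒴r i)) → Fin M),
      ∃ D : BlockCode 𝒳 𝒳r 𝒴r n M L, ∑ x, μ x * expect (D.prob ch (s x) (w x))
        (fun ω => ind (¬t.Good y₀ D (s x) ω (w x))) ≤ ε * ∑ x, μ x) (b : ℕ) :
    ∃ (c : RelayCode 𝒳 𝒴 𝒳r 𝒴r K (n * b)) (σ : ∀ i, (Fin (n * b) → 𝒴r i) → Fin (L i))
      (G : Fin K → (Fin (n * b) → 𝒴 × (∀ i, 𝒴r i)) → Prop),
      TransmitsDigits ch c σ G φ b (b * (ε * K)) := by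
  induction b with
  | zero =>
    refine ⟨⟨fun _ k => absurd k.2 (by simp), fun _ k => absurd k.2 (by simp), fun _ => ⟨0, hK⟩⟩,
      fun i _ => ⟨0, hL i⟩, fun _ _ => True, ⟨fun w => ?_, ?_, ?_⟩⟩
    · simp [RelayChannel.blockProb]
    · simp [ind]
    · simp
  | succ b ih =>
    obtain ⟨c, σ, G, h⟩ := ih
    obtain ⟨c', σ', G', h', -⟩ := h.append (hblock _)
    have hδ : ((b + 1 : ℕ) : ℝ) * (ε * K) = b * (ε * K) + ε * K := by push_cast; ring
    exact ⟨c', σ', G', hδ ▸ h'⟩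

/-- A code whose message is determined by the outputs at the destination in the good cases can be
decoded; idle symbols may be added at the end. -/
theorem exists_errorProb_le_of_unique {K m : ℕ} (c : RelayCode 𝒳 𝒴 𝒳r 𝒴r K m)
    (G : Fin K → (Fin m → 𝒴 × (∀ i, 𝒴r i)) → Prop) {δ : ℝ}
    (hfail : ∑ w, ∑ ω, ch.blockProb c w ω * ind (¬G w ω) ≤ δ * K) (hK : 0 < K)
    (hG : ∀ w w' ω ω', G w ω → G w' ω' → (∀ k, (ω k).1 = (ω' k).1) → w = w')
    (x₀ : 𝒳) (xr₀ : ∀ i, 𝒳r i) (r : ℕ) :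
    ∃ c' : RelayCode 𝒳 𝒴 𝒳r 𝒴r K (m + r), ch.errorProb c' ≤ δ := by
  classical
  set d := c.append (r := r) (fun _ _ => x₀) (fun i _ _ => xr₀ i) with hd
  set c' : RelayCode 𝒳 𝒴 𝒳r 𝒴r K (m + r) :=
    { d with
      dec := fun y => if h : ∃ w ω, G w ω ∧ ∀ k, (ω k).1 = y (Fin.castAdd r k) then h.choose
        else ⟨0, hK⟩ } with hc'
  have hdec : ∀ w ω ω', G w ω → c'.dec (fun k => (Fin.append ω ω' k).1) = w := by
    intro w ω ω' hg
    have h : ∃ w' ω'', G w' ω'' ∧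
        ∀ k, (ω'' k).1 = (Fin.append ω ω' (Fin.castAdd r k) : 𝒴 × (∀ i, 𝒴r i)).1 :=
      ⟨w, ω, hg, fun k => by rw [Fin.append_left]⟩
    have h1 : c'.dec (fun k => (Fin.append ω ω' k).1) = h.choose := dif_pos h
    rw [h1]
    obtain ⟨ω'', hg', hy⟩ := h.choose_spec
    refine hG _ _ _ _ hg' hg fun k => ?_
    rw [hy k, Fin.append_left]
  refine ⟨c', ?_⟩
  have hK' : (0 : ℝ) < K := Nat.cast_pos.2 hK
  rw [RelayChannel.errorProb, div_le_iff₀ hK']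
  refine le_trans (Finset.sum_le_sum fun w _ => ?_) hfail
  have h1 : ∀ ω, (if c'.dec (fun k => (ω k).1) ≠ w then ch.blockProb c' w ω else 0) =
      ch.blockProb d w ω * ind (c'.dec (fun k => (ω k).1) ≠ w) := by
    intro ω
    rw [ind]
    split_ifs
    · rw [mul_one]; rfl
    · rw [mul_zero]
  simp_rw [h1]
  rw [hd, ch.sum_blockProb_append_mul]
  refine Finset.sum_le_sum fun ω _ => mul_le_mul_of_nonneg_left ?_ (ch.blockProb_nonneg c w ω)
  refine expect_le (fun ω' => Finset.prod_nonneg fun _ _ => (ch.prob_mem _ _).1 _)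
    (ch.sum_prob_word (fun _ _ => x₀) (fun i _ _ => xr₀ i) w ω) fun ω' => ind_mono ?_
  exact fun hne hg => hne (hdec w ω ω' hg)

end Chain

/-! ### Random subsets -/

section Subsets

variable {N : ℕ} (q : Fin N → ℝ)

theorem subsetProb_insert_right {T S : Finset (Fin N)} {a : Fin N} (ha : a ∉ T) (hS : S ⊆ T) :
    subsetProb q (insert a T) S = (1 - q a) * subsetProb q T S := by
  rw [subsetProb, subsetProb, Finset.insert_sdiff_of_notMem _ fun h => ha (hS h),
    Finset.prod_insert fun h => ha (Finset.mem_sdiff.1 h).1]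
  ring

theorem subsetProb_insert_insert {T S : Finset (Fin N)} {a : Fin N} (ha : a ∉ T) (hS : S ⊆ T) :
    subsetProb q (insert a T) (insert a S) = q a * subsetProb q T S := by
  have h1 : insert a T \ insert a S = T \ S := by
    ext b
    simp only [Finset.mem_sdiff, Finset.mem_insert]
    constructor
    · rintro ⟨h | h, h'⟩
      · exact absurd (Or.inl h) h'
      · exact ⟨h, fun hb => h' (Or.inr hb)⟩
    · rintro ⟨h, h'⟩
      refine ⟨Or.inr h, ?_⟩
      rintro (rfl | hb)
      · exact ha h
      · exact h' hb
  rw [subsetProb, subsetProb, h1, Finset.prod_insert fun h => ha (hS h)]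
  ring

/-- A sum over the subsets of `insert a T`, split according to whether they contain `a`. -/
theorem sum_subsetProb_insert {T : Finset (Fin N)} {a : Fin N} (ha : a ∉ T)
    (g : Finset (Fin N) → ℝ) :
    ∑ S ∈ (insert a T).powerset, subsetProb q (insert a T) S * g S =
      (1 - q a) * ∑ S ∈ T.powerset, subsetProb q T S * g S +
        q a * ∑ S ∈ T.powerset, subsetProb q T S * g (insert a S) := by
  rw [Finset.sum_powerset_insert ha, Finset.mul_sum, Finset.mul_sum]
  congr 1 <;> refine Finset.sum_congr rfl fun S hS => ?_
  · rw [subsetProb_insert_right q ha (Finset.mem_powerset.1 hS), mul_assoc]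
  · rw [subsetProb_insert_insert q ha (Finset.mem_powerset.1 hS), mul_assoc]

/-- The intersection with `T` of a random subset of `U` is a random subset of `T`. -/
theorem sum_subsetProb_inter {T U : Finset (Fin N)} (hTU : T ⊆ U) (g : Finset (Fin N) → ℝ) :
    ∑ θ ∈ U.powerset, subsetProb q U θ * g (θ ∩ T) =
      ∑ S ∈ T.powerset, subsetProb q T S * g S := by
  suffices h : ∀ V : Finset (Fin N), Disjoint V T →
      ∑ θ ∈ (V ∪ T).powerset, subsetProb q (V ∪ T) θ * g (θ ∩ T) =
        ∑ S ∈ T.powerset, subsetProb q T S * g S by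
    have := h (U \ T) Finset.sdiff_disjoint
    rwa [Finset.sdiff_union_of_subset hTU] at this
  intro V
  induction V using Finset.induction_on with
  | empty =>
    intro _
    rw [Finset.empty_union]
    refine Finset.sum_congr rfl fun S hS => ?_
    rw [Finset.inter_eq_left.2 (Finset.mem_powerset.1 hS)]
  | insert a V ha ih =>
    intro hd
    rw [Finset.disjoint_insert_left] at hd
    have ha' : a ∉ V ∪ T := by simp [ha, hd.1]
    rw [Finset.insert_union, sum_subsetProb_insert q ha' fun θ => g (θ ∩ T)]
    have h1 : ∀ S : Finset (Fin N), insert a S ∩ T = S ∩ T := fun S =>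
      Finset.insert_inter_of_notMem hd.1
    simp_rw [h1, ih hd.2]
    ring

/-- The contribution of the subsets that contain `i`. -/
theorem sum_subsetProb_mem_inter {T : Finset (Fin N)} {i : Fin N} (hi : i ∉ T)
    (g : Finset (Fin N) → ℝ) :
    ∑ θ, subsetProb q univ θ * (if i ∈ θ then g (θ ∩ T) else 0) =
      q i * ∑ S ∈ T.powerset, subsetProb q T S * g S := by
  have h := sum_subsetProb_inter q (Finset.subset_univ (insert i T))
    fun S => if i ∈ S then g (S ∩ T) else 0
  rw [Finset.powerset_univ, sum_subsetProb_insert q hi] at h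
  have h1 : ∀ θ : Finset (Fin N), θ ∩ insert i T ∩ T = θ ∩ T := fun θ => by
    rw [Finset.inter_assoc, Finset.inter_eq_right.2 (Finset.subset_insert i T)]
  simp only [Finset.mem_inter, Finset.mem_insert_self, and_true, h1, if_true] at h
  rw [h]
  have h2 : ∑ S ∈ T.powerset, subsetProb q T S * (if i ∈ S then g (S ∩ T) else 0) = 0 :=
    Finset.sum_eq_zero fun S hS => by
      rw [if_neg fun h => hi (Finset.mem_powerset.1 hS h), mul_zero]
  rw [h2, mul_zero, zero_add]
  congr 1
  refine Finset.sum_congr rfl fun S hS => ?_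
  rw [Finset.insert_inter_of_notMem hi, Finset.inter_eq_left.2 (Finset.mem_powerset.1 hS)]

end Subsets

/-! ### The single-letter quantities -/

section SingleLetter

variable {N : ℕ} {𝒳 𝒴 : Type*} {𝒳r 𝒴r : Fin N → Type*}

theorem relayOutsOn_eq_iff {S : Finset (Fin N)} {ω ω' : Outcome 𝒳 𝒴 𝒳r 𝒴r} :
    relayOutsOn S ω' = relayOutsOn S ω ↔ ∀ i ∈ S, relayOut i ω' = relayOut i ω := by
  constructor
  · exact fun h i hi => congrFun h ⟨i, hi⟩
  · exact fun h => funext fun i => h i i.2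

theorem maskOut_eq_iff {y₀ : ∀ i, 𝒴r i} {θ : Finset (Fin N)} {y y' : ∀ i, 𝒴r i} {i : Fin N} :
    maskOut y₀ θ y' i = maskOut y₀ θ y i ↔ (i ∈ θ → y' i = y i) := by
  simp only [maskOut]
  split_ifs with h <;> simp [h]

theorem law_eq_sum_ind {Ω α : Type*} [Fintype Ω] (P : Ω → ℝ) (U : Ω → α) (a : α) :
    law P U a = ∑ ω, P ω * ind (U ω = a) := by
  refine Finset.sum_congr rfl fun ω _ => ?_
  by_cases h : U ω = a <;> simp [h, ind]

theorem prob_ne_zero_of_joint_ne_zero [Fintype 𝒴] [∀ i, Fintype (𝒴r i)]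
    (ch : RelayChannel 𝒳 𝒴 𝒳r 𝒴r) {p : 𝒳 → ℝ} {pr : ∀ i, 𝒳r i → ℝ}
    {ω : Outcome 𝒳 𝒴 𝒳r 𝒴r} (h : ch.joint p pr ω ≠ 0) :
    p (srcIn ω) ≠ 0 ∧ ∀ i, pr i (relayIn i ω) ≠ 0 := by
  rw [RelayChannel.joint, mul_ne_zero_iff, mul_ne_zero_iff, Finset.prod_ne_zero_iff] at h
  exact ⟨h.1.1, fun i => h.1.2 i (mem_univ i)⟩

variable [Fintype 𝒳] [Fintype 𝒴] [∀ i, Fintype (𝒳r i)] [∀ i, Fintype (𝒴r i)]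

/-- The conditional entropy of `U` given `X₁, …, X_N`, `Y` and the `Y_i` with `i` in `S`. -/
noncomputable def entropyGiven {α : Type*} [Fintype α] (P : Outcome 𝒳 𝒴 𝒳r 𝒴r → ℝ)
    (U : Outcome 𝒳 𝒴 𝒳r 𝒴r → α) (S : Finset (Fin N)) : ℝ :=
  condEntropy P U fun ω => (relayOutsOn S ω, insAndOut ω)

theorem sub_sum_condMutualInfo {α : Type*} [Fintype α] (P : Outcome 𝒳 𝒴 𝒳r 𝒴r → ℝ)
    (U : Outcome 𝒳 𝒴 𝒳r 𝒴r → α) (T : Finset (Fin N)) (q : Fin N → ℝ) :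
    condEntropy P U insAndOut - ∑ S ∈ T.powerset.erase ∅,
      subsetProb q T S * condMutualInfo P U (relayOutsOn S) insAndOut =
    ∑ S ∈ T.powerset, subsetProb q T S * entropyGiven P U S := by
  have h0 : condMutualInfo P U (relayOutsOn ∅) insAndOut = 0 := by
    rw [condMutualInfo, sub_eq_zero]
    refine condEntropy_congr (fun ω ω' _ _ => ?_) fun _ _ _ _ _ => Iff.rfl
    simp only [Prod.mk.injEq, iff_and_self]
    exact fun _ => relayOutsOn_eq_iff.2 (by simp)
  rw [Finset.sum_erase _ (by rw [h0, mul_zero])]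
  simp only [condMutualInfo, mul_sub, Finset.sum_sub_distrib, ← Finset.sum_mul, sum_subsetProb,
    one_mul, sub_sub_cancel]
  rfl

theorem qDen_eq_sum (P : Outcome 𝒳 𝒴 𝒳r 𝒴r → ℝ) (T : Finset (Fin N)) (q : Fin N → ℝ)
    (i : Fin N) :
    qDen P T q i = ∑ S ∈ T.powerset, subsetProb q T S * entropyGiven P (relayOut i) S :=
  sub_sum_condMutualInfo P (relayOut i) T q

theorem eafRate_eq_sub_sum (P : Outcome 𝒳 𝒴 𝒳r 𝒴r → ℝ) (q : Fin N → ℝ) :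
    eafRate P q = condEntropy P srcIn relayIns -
      ∑ S, subsetProb q univ S * entropyGiven P srcIn S := by
  have h1 := sub_sum_condMutualInfo P srcIn univ q
  have h2 : condEntropy P srcIn (fun ω => (dstOut ω, relayIns ω)) =
      condEntropy P srcIn insAndOut := by
    refine condEntropy_congr (fun ω ω' _ _ => ?_) fun _ _ _ _ _ => Iff.rfl
    simp only [insAndOut, Prod.mk.injEq]
    exact and_comm
  rw [eafRate, condMutualInfo, h2, ← Finset.powerset_univ, ← h1]
  ring

theorem condEntropy_maskOut {α : Type*} [Fintype α] (P : Outcome 𝒳 𝒴 𝒳r 𝒴r → ℝ)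
    (U : Outcome 𝒳 𝒴 𝒳r 𝒴r → α) (y₀ : ∀ i, 𝒴r i) (θ T : Finset (Fin N)) :
    condEntropy P U (fun ω => (insAndOut ω, fun j : T => maskOut y₀ θ ω.2.2.2 j)) =
      entropyGiven P U (θ ∩ T) := by
  refine condEntropy_congr (fun ω ω' _ _ => ?_) fun _ _ _ _ _ => Iff.rfl
  simp only [Prod.mk.injEq]
  rw [relayOutsOn_eq_iff]
  simp only [funext_iff, Subtype.forall, maskOut_eq_iff, Finset.mem_inter, relayOut]
  constructor
  · exact fun h => ⟨fun i hi => h.2 i hi.2 hi.1, h.1⟩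
  · exact fun h => ⟨h.2, fun i hi hi' => h.1 i ⟨hi', hi⟩⟩

theorem condEntropy_maskOut_univ {α : Type*} [Fintype α] (P : Outcome 𝒳 𝒴 𝒳r 𝒴r → ℝ)
    (U : Outcome 𝒳 𝒴 𝒳r 𝒴r → α) (y₀ : ∀ i, 𝒴r i) (θ : Finset (Fin N)) :
    condEntropy P U (fun ω => (insAndOut ω, maskOut y₀ θ ω.2.2.2)) = entropyGiven P U θ := by
  refine condEntropy_congr (fun ω ω' _ _ => ?_) fun _ _ _ _ _ => Iff.rfl
  simp only [Prod.mk.injEq]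
  rw [relayOutsOn_eq_iff, and_comm]
  simp only [funext_iff, maskOut_eq_iff, relayOut]

theorem condEntropy_eq_zero_of_const {Ω α β : Type*} [Fintype Ω] [Fintype α] [Fintype β]
    {P : Ω → ℝ} (hP : ∀ ω, 0 ≤ P ω) (a : α) (V : Ω → β) : condEntropy P (fun _ => a) V = 0 := by
  rw [condEntropy_eq_neg_sum, neg_eq_zero]
  refine Finset.sum_eq_zero fun ω _ => ?_
  by_cases h0 : P ω = 0
  · rw [h0, zero_mul]
  · rw [condProb, law_apply_congr (U := fun ω => (a, V ω)) (V := V) (ω := ω) (by simp),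
      div_self (law_pos hP V h0).ne', Real.logb_one, mul_zero]

theorem condEntropy_maskOut_maskOut {P : Outcome 𝒳 𝒴 𝒳r 𝒴r → ℝ} (hP : ∀ ω, 0 ≤ P ω)
    (y₀ : ∀ i, 𝒴r i) (θ T : Finset (Fin N)) (i : Fin N) :
    condEntropy P (fun ω => maskOut y₀ θ ω.2.2.2 i)
      (fun ω => (insAndOut ω, fun j : T => maskOut y₀ θ ω.2.2.2 j)) =
      if i ∈ θ then entropyGiven P (relayOut i) (θ ∩ T) else 0 := by
  rw [condEntropy_maskOut]
  split_ifs with hi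
  · refine condEntropy_congr (fun _ _ _ _ => Iff.rfl) fun ω ω' _ _ _ => ?_
    simp [maskOut, hi, relayOut]
  · have : (fun ω : Outcome 𝒳 𝒴 𝒳r 𝒴r => maskOut y₀ θ ω.2.2.2 i) = fun _ => y₀ i := by
      funext ω
      simp [maskOut, hi]
    rw [this]
    exact condEntropy_eq_zero_of_const hP _ _

/-- The expected logarithm of a likelihood ratio is a difference of conditional entropies. -/
theorem sum_mul_logb_condProb_div {Ω α β γ : Type*} [Fintype Ω] [Fintype α] [Fintype β] [Fintype γ]
    {P : Ω → ℝ} (hP : ∀ ω, 0 ≤ P ω) (U : Ω → α) (V : Ω → β) (W : Ω → γ) (q : α → ℝ)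
    (hW : ∀ ω, P ω ≠ 0 → condProb P U W (U ω) (W ω) = q (U ω)) :
    ∑ ω, P ω * Real.logb 2 (condProb P U V (U ω) (V ω) / q (U ω)) =
      condEntropy P U W - condEntropy P U V := by
  rw [condEntropy_eq_neg_sum, condEntropy_eq_neg_sum, neg_sub_neg, ← Finset.sum_sub_distrib]
  refine Finset.sum_congr rfl fun ω _ => ?_
  by_cases h0 : P ω = 0
  · simp [h0]
  · rw [hW ω h0, Real.logb_div (condProb_pos hP U V h0).ne', mul_sub]
    rw [← hW ω h0]
    exact (condProb_pos hP U W h0).ne'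

variable (ch : RelayChannel 𝒳 𝒴 𝒳r 𝒴r) {p : 𝒳 → ℝ} {pr : ∀ i, 𝒳r i → ℝ}
  (hp : p ∈ stdSimplex ℝ 𝒳) (hpr : ∀ i, pr i ∈ stdSimplex ℝ (𝒳r i))

include hpr in
/-- The input of relay `i` is independent of the inputs of other relays. -/
theorem law_relayIn_relayInsOn {Z : Finset (Fin N)} {i : Fin N} (hi : i ∉ Z) (u : 𝒳r i)
    (z : ∀ j : Z, 𝒳r j) :
    law (ch.joint p pr) (fun ω => (relayIn i ω, relayInsOn Z ω)) (u, z) =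
      pr i u * law (ch.joint p pr) (relayInsOn Z) z := by
  rw [law_eq_sum_ind, law_eq_sum_ind]
  have h1 := sum_joint_mul_inputs ch p pr
    fun _ xr => ind ((xr i, fun j : Z => xr j) = (u, z))
  have h2 := sum_joint_mul_inputs ch p pr fun _ xr => ind ((fun j : Z => xr j) = z)
  refine h1.trans (Eq.trans ?_ (congrArg (pr i u * ·) h2.symm))
  have h3 := expect_prodWeight_resample (q := pr) i (hpr i).2
    (fun xr u' => ind ((u', fun j : Z => xr j) = (u, z))) (by
      intro xr u' v
      have : (fun j : Z => Function.update xr i u' j) = fun j : Z => xr j := by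
        funext j
        rw [Function.update_of_ne]
        rintro rfl
        exact hi j.2
      rw [this])
  have h4 : ∀ xr : ∀ i, 𝒳r i, expect (pr i) (fun u' => ind ((u', fun j : Z => xr j) = (u, z))) =
      pr i u * ind ((fun j : Z => xr j) = z) := by
    intro xr
    rw [expect, Finset.sum_eq_single u]
    · simp
    · intro b _ hb
      rw [ind_of_false, mul_zero]
      simp [hb]
    · simp
  simp_rw [h4, expect_mul_left] at h3
  rw [Finset.mul_sum]
  refine Finset.sum_congr rfl fun x _ => ?_
  rw [mul_left_comm]
  exact congrArg (p x * ·) h3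

include hp in
/-- The input of the source is independent of the inputs of the relays. -/
theorem law_srcIn_relayIns (x : 𝒳) (xr : ∀ i, 𝒳r i) :
    law (ch.joint p pr) (fun ω => (srcIn ω, relayIns ω)) (x, xr) =
      p x * law (ch.joint p pr) relayIns xr := by
  classical
  rw [law_eq_sum_ind, law_eq_sum_ind]
  have h1 := sum_joint_mul_inputs ch p pr fun x' xr' => ind ((x', xr') = (x, xr))
  have h2 := sum_joint_mul_inputs ch p pr fun _ xr' => ind (xr' = xr)
  refine h1.trans (Eq.trans ?_ (congrArg (p x * ·) h2.symm))
  rw [← Finset.sum_mul, hp.2, one_mul, Finset.sum_eq_single x]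
  · simp
  · intro b _ hb
    refine mul_eq_zero_of_right _ (Finset.sum_eq_zero fun xr' _ => mul_eq_zero_of_right _ ?_)
    exact ind_of_false (by simp [hb])
  · simp

include hp hpr in
theorem sum_joint_mul_logb_relay {Z : Finset (Fin N)} {i : Fin N} (hi : i ∉ Z) :
    ∑ ω, ch.joint p pr ω * Real.logb 2 (condProb (ch.joint p pr) (relayIn i)
      (fun ω => (dstOut ω, relayInsOn Z ω)) (relayIn i ω) (dstOut ω, relayInsOn Z ω) /
        pr i (relayIn i ω)) = qNum (ch.joint p pr) Z i := by
  have hP := joint_nonneg ch hp hpr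
  refine sum_mul_logb_condProb_div hP (relayIn i) (fun ω => (dstOut ω, relayInsOn Z ω))
    (relayInsOn Z) (pr i) fun ω hω => ?_
  rw [condProb, law_relayIn_relayInsOn ch hpr hi,
    mul_div_cancel_right₀ _ (law_pos hP (relayInsOn Z) hω).ne']

include hp hpr in
theorem qNum_nonneg {Z : Finset (Fin N)} {i : Fin N} (hi : i ∉ Z) :
    0 ≤ qNum (ch.joint p pr) Z i := by
  rw [← sum_joint_mul_logb_relay ch hp hpr hi]
  exact sum_mul_logb_condProb_div_nonneg (joint_nonneg ch hp hpr) (sum_joint ch hp hpr)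
    (relayIn i) (fun ω => (dstOut ω, relayInsOn Z ω)) (pr i) (hpr i).1 (hpr i).2
    fun ω hω => (prob_ne_zero_of_joint_ne_zero ch hω).2 i

include hp hpr in
theorem sum_joint_mul_logb_source (y₀ : ∀ i, 𝒴r i) (θ : Finset (Fin N)) :
    ∑ ω, ch.joint p pr ω * Real.logb 2 (condProb (ch.joint p pr) srcIn
      (fun ω => (insAndOut ω, maskOut y₀ θ ω.2.2.2)) (srcIn ω)
        (insAndOut ω, maskOut y₀ θ ω.2.2.2) / p (srcIn ω)) =
      condEntropy (ch.joint p pr) srcIn relayIns - entropyGiven (ch.joint p pr) srcIn θ := by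
  have hP := joint_nonneg ch hp hpr
  rw [← condEntropy_maskOut_univ _ _ y₀]
  refine sum_mul_logb_condProb_div hP srcIn (fun ω => (insAndOut ω, maskOut y₀ θ ω.2.2.2))
    relayIns p fun ω hω => ?_
  rw [condProb, law_srcIn_relayIns ch hp,
    mul_div_cancel_right₀ _ (law_pos hP relayIns hω).ne']

end SingleLetter

/-! ### Likelihood ratio tests -/

section LikelihoodTests

variable {N : ℕ} {𝒳 𝒴 : Type*} {𝒳r 𝒴r : Fin N → Type*}
  [Fintype 𝒳] [Fintype 𝒴] [∀ i, Fintype (𝒳r i)] [∀ i, Fintype (𝒴r i)]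

/-- The tests whose scores are the likelihood ratios of the words, and the conditional
probabilities of the masked outputs, under the single-letter distribution. -/
noncomputable def likelihoodTests (ch : RelayChannel 𝒳 𝒴 𝒳r 𝒴r) (p : 𝒳 → ℝ)
    (pr : ∀ i, 𝒳r i → ℝ) (precX precY : Fin N → Fin N → Prop) (y₀ : ∀ i, 𝒴r i)
    (a b : Fin N → ℝ) (c : ℝ) : Tests 𝒳 𝒴 𝒳r 𝒴r precX precY where
  relay i u v := condProb (ch.joint p pr) (relayIn i)
    (fun ω => (dstOut ω, relayInsOn (before precX i) ω)) u v / pr i u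
  index θ i u v := condProb (ch.joint p pr) (fun ω => maskOut y₀ θ ω.2.2.2 i)
    (fun ω => (insAndOut ω, fun j : before precY i => maskOut y₀ θ ω.2.2.2 j)) u v
  source θ u v := condProb (ch.joint p pr) srcIn
    (fun ω => (insAndOut ω, maskOut y₀ θ ω.2.2.2)) u v / p u
  relayExp := a
  indexExp := b
  sourceExp := c

theorem not_mem_before (prec : Fin N → Fin N → Prop) [IsStrictOrder (Fin N) prec] (i : Fin N) :
    i ∉ before prec i := by
  simpa [before] using irrefl (r := prec) i

variable (ch : RelayChannel 𝒳 𝒴 𝒳r 𝒴r) {p : 𝒳 → ℝ} {pr : ∀ i, 𝒳r i → ℝ}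
  (hp : p ∈ stdSimplex ℝ 𝒳) (hpr : ∀ i, pr i ∈ stdSimplex ℝ (𝒳r i))
  {precX precY : Fin N → Fin N → Prop} (y₀ : ∀ i, 𝒴r i) {a b : Fin N → ℝ} {c : ℝ}

theorem mul_div_self_le {x y : ℝ} (hy : 0 ≤ y) : x * (y / x) ≤ y := by
  by_cases hx : x = 0
  · simpa [hx] using hy
  · rw [mul_div_cancel₀ _ hx]

include hp hpr in
theorem likelihoodTests_normalized :
    (likelihoodTests ch p pr precX precY y₀ a b c).Normalized p pr y₀ := by
  have hP := joint_nonneg ch hp hpr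
  refine ⟨fun i u v => ?_, fun i v => ?_, fun θ i u v => ?_, fun θ i v => ?_,
    fun θ i u v hi h => ?_, fun θ u v => ?_, fun θ v => ?_⟩
  · exact div_nonneg (condProb_nonneg hP _ _ _ _) ((hpr i).1 _)
  · exact (Finset.sum_le_sum fun u _ => mul_div_self_le (condProb_nonneg hP _ _ _ _)).trans
      (sum_condProb_le_one _ _ _)
  · exact condProb_nonneg hP _ _ _ _
  · exact sum_condProb_le_one _ _ _
  · by_contra hu
    refine h (div_eq_zero_iff.2 (Or.inl ?_))
    rw [law_eq_sum_ind]
    refine Finset.sum_eq_zero fun ω _ => mul_eq_zero_of_right _ (ind_of_false fun h' => hu ?_)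
    have h1 : maskOut y₀ θ ω.2.2.2 i = u := congrArg Prod.fst h'
    rw [← h1]
    simp [maskOut, hi]
  · exact div_nonneg (condProb_nonneg hP _ _ _ _) (hp.1 _)
  · exact (Finset.sum_le_sum fun u _ => mul_div_self_le (condProb_nonneg hP _ _ _ _)).trans
      (sum_condProb_le_one _ _ _)

variable {q : Fin N → ℝ} [IsStrictOrder (Fin N) precX] [IsStrictOrder (Fin N) precY]

theorem sum_maskedJoint_mul (f : Finset (Fin N) × Outcome 𝒳 𝒴 𝒳r 𝒴r → ℝ) :
    ∑ o, maskedJoint ch q p pr o * f o =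
      ∑ θ, subsetProb q univ θ * ∑ ω, ch.joint p pr ω * f (θ, ω) := by
  rw [Fintype.sum_prod_type]
  refine Finset.sum_congr rfl fun θ _ => ?_
  rw [Finset.mul_sum]
  exact Finset.sum_congr rfl fun ω _ => mul_assoc _ _ _

include hp hpr in
/-- The expected logarithms of the scores are the information quantities of the rate formula. -/
theorem likelihoodTests_reliable
    (ha : ∀ i, a i < qNum (ch.joint p pr) (before precX i) i)
    (hb : ∀ i, b i < -(q i * qDen (ch.joint p pr) (before precY i) q i))
    (hc : c < eafRate (ch.joint p pr) q) :
    (likelihoodTests ch p pr precX precY y₀ a b c).Reliable y₀ (maskedJoint ch q p pr) := by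
  have hP := joint_nonneg ch hp hpr
  have h0 : ∀ o, maskedJoint ch q p pr o ≠ 0 → ch.joint p pr o.2 ≠ 0 :=
    fun o ho => (mul_ne_zero_iff.1 ho).2
  refine ⟨fun i o ho => ?_, fun i => ?_, fun i o ho => ?_, fun i => ?_, fun o ho => ?_, ?_⟩
  · refine div_pos (condProb_pos hP (relayIn i)
      (fun ω => (dstOut ω, relayInsOn (before precX i) ω)) (h0 o ho)) ?_
    exact ((hpr i).1 _).lt_of_ne' ((prob_ne_zero_of_joint_ne_zero ch (h0 o ho)).2 i)
  · refine (ha i).trans_eq ?_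
    rw [sum_maskedJoint_mul, ← sum_joint_mul_logb_relay ch hp hpr (not_mem_before precX i)]
    refine (one_mul _).symm.trans ?_
    rw [← sum_subsetProb_univ q, Finset.sum_mul]
    rfl
  · exact condProb_pos hP (fun ω => maskOut y₀ o.1 ω.2.2.2 i)
      (fun ω => (insAndOut ω, fun j : before precY i => maskOut y₀ o.1 ω.2.2.2 j)) (h0 o ho)
  · refine (hb i).trans_eq ?_
    rw [sum_maskedJoint_mul, qDen_eq_sum,
      ← sum_subsetProb_mem_inter q (not_mem_before precY i), ← Finset.sum_neg_distrib]
    refine Finset.sum_congr rfl fun θ _ => ?_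
    rw [← condEntropy_maskOut_maskOut hP y₀, condEntropy_eq_neg_sum, mul_neg, neg_neg]
    rfl
  · refine div_pos (condProb_pos hP srcIn
      (fun ω => (insAndOut ω, maskOut y₀ o.1 ω.2.2.2)) (h0 o ho)) ?_
    exact (hp.1 _).lt_of_ne' (prob_ne_zero_of_joint_ne_zero ch (h0 o ho)).1
  · refine hc.trans_eq ?_
    have h1 : ∀ θ, ∑ ω, ch.joint p pr ω * Real.logb 2
        ((likelihoodTests ch p pr precX precY y₀ a b c).sourceVar y₀ (θ, ω)) =
        condEntropy (ch.joint p pr) srcIn relayIns - entropyGiven (ch.joint p pr) srcIn θ :=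
      fun θ => sum_joint_mul_logb_source ch hp hpr y₀ θ
    rw [sum_maskedJoint_mul, eafRate_eq_sub_sum]
    simp_rw [h1, mul_sub, Finset.sum_sub_distrib, ← Finset.sum_mul, sum_subsetProb_univ, one_mul]

end LikelihoodTests

/-! ### Strictly feasible mask probabilities -/

section Perturbation

theorem subsetProb_congr {N : ℕ} {q q' : Fin N → ℝ} {T S : Finset (Fin N)} (hS : S ⊆ T)
    (h : ∀ j ∈ T, q j = q' j) : subsetProb q T S = subsetProb q' T S := by
  rw [subsetProb, subsetProb, Finset.prod_congr rfl fun j hj => h j (hS hj),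
    Finset.prod_congr rfl fun j (hj : j ∈ T \ S) => by rw [h j (Finset.mem_sdiff.1 hj).1]]

theorem clippedRatio_mem {a b : ℝ} (ha : 0 ≤ a) (hb : 0 ≤ b) :
    0 ≤ clippedRatio a b ∧ clippedRatio a b ≤ 1 := by
  rw [clippedRatio]
  split_ifs
  · exact ⟨zero_le_one, le_rfl⟩
  · exact ⟨le_min (div_nonneg ha hb) zero_le_one, min_le_right _ _⟩

theorem tendsto_clippedRatio {ι : Type*} {l : Filter ι} (a : ℝ) {f : ι → ℝ} {b : ℝ} (hb : b ≠ 0)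
    (hf : Tendsto f l (𝓝 b)) :
    Tendsto (fun x => clippedRatio a (f x)) l (𝓝 (clippedRatio a b)) := by
  have h : Tendsto (fun x => min (a / f x) 1) l (𝓝 (min (a / b) 1)) :=
    (tendsto_const_nhds.div hf hb).min tendsto_const_nhds
  rw [clippedRatio, if_neg hb]
  refine h.congr' ?_
  filter_upwards [hf.eventually_ne hb] with x hx
  rw [clippedRatio, if_neg hx]

variable {N : ℕ} {𝒳 𝒴 : Type*} {𝒳r 𝒴r : Fin N → Type*}
  [Fintype 𝒳] [Fintype 𝒴] [∀ i, Fintype (𝒳r i)] [∀ i, Fintype (𝒴r i)]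
  {P : Outcome 𝒳 𝒴 𝒳r 𝒴r → ℝ} (hP : ∀ ω, 0 ≤ P ω)

theorem qDen_congr {q q' : Fin N → ℝ} {T : Finset (Fin N)} (h : ∀ j ∈ T, q j = q' j)
    (i : Fin N) : qDen P T q i = qDen P T q' i := by
  rw [qDen_eq_sum, qDen_eq_sum]
  exact Finset.sum_congr rfl fun S hS => by rw [subsetProb_congr (Finset.mem_powerset.1 hS) h]

include hP in
theorem qDen_nonneg {q : Fin N → ℝ} {T : Finset (Fin N)} (hq : ∀ j ∈ T, 0 ≤ q j ∧ q j ≤ 1)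
    (i : Fin N) : 0 ≤ qDen P T q i := by
  rw [qDen_eq_sum]
  exact Finset.sum_nonneg fun S hS => mul_nonneg (subsetProb_nonneg (Finset.mem_powerset.1 hS)
    (fun j hj => (hq j hj).1) fun j hj => (hq j hj).2) (condEntropy_nonneg hP _ _)

theorem tendsto_subsetProb {ι : Type*} {l : Filter ι} {f : ι → Fin N → ℝ} {q : Fin N → ℝ}
    {T S : Finset (Fin N)} (hS : S ⊆ T) (hf : ∀ j ∈ T, Tendsto (fun x => f x j) l (𝓝 (q j))) :
    Tendsto (fun x => subsetProb (f x) T S) l (𝓝 (subsetProb q T S)) :=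
  (tendsto_finsetProd _ fun j hj => hf j (hS hj)).mul
    (tendsto_finsetProd _ fun j hj =>
      tendsto_const_nhds.sub (hf j (Finset.mem_sdiff.1 hj).1))

theorem tendsto_qDen {ι : Type*} {l : Filter ι} {f : ι → Fin N → ℝ} {q : Fin N → ℝ}
    {T : Finset (Fin N)} (hf : ∀ j ∈ T, Tendsto (fun x => f x j) l (𝓝 (q j))) (i : Fin N) :
    Tendsto (fun x => qDen P T (f x) i) l (𝓝 (qDen P T q i)) := by
  simp_rw [qDen_eq_sum]
  exact tendsto_finsetSum _ fun S hS =>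
    (tendsto_subsetProb (Finset.mem_powerset.1 hS) hf).mul tendsto_const_nhds

theorem tendsto_eafRate {ι : Type*} {l : Filter ι} {f : ι → Fin N → ℝ} {q : Fin N → ℝ}
    (hf : ∀ j, Tendsto (fun x => f x j) l (𝓝 (q j))) :
    Tendsto (fun x => eafRate P (f x)) l (𝓝 (eafRate P q)) := by
  simp_rw [eafRate_eq_sub_sum]
  exact tendsto_const_nhds.sub (tendsto_finsetSum _ fun S _ =>
    (tendsto_subsetProb (Finset.subset_univ _) fun j _ => hf j).mul tendsto_const_nhds)

include hP in
/-- If the output of relay `i` is determined by the inputs, the output at the destination and a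
random set of outputs of other relays, then masking it does not change average entropies. -/
theorem sum_subsetProb_update_zero {α : Type*} [Fintype α] (U : Outcome 𝒳 𝒴 𝒳r 𝒴r → α)
    {q : Fin N → ℝ} (hq : ∀ i, 0 ≤ q i ∧ q i ≤ 1) {T T' : Finset (Fin N)} {i : Fin N}
    (hiT' : i ∉ T') (hT' : i ∈ T → T' ⊆ T) (h0 : qDen P T' q i = 0) :
    ∑ S ∈ T.powerset, subsetProb (Function.update q i 0) T S * entropyGiven P U S =
      ∑ S ∈ T.powerset, subsetProb q T S * entropyGiven P U S := by
  by_cases hiT : i ∈ T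
  swap
  · refine Finset.sum_congr rfl fun S hS => congrArg (· * _) ?_
    exact subsetProb_congr (Finset.mem_powerset.1 hS) fun j hj =>
      Function.update_of_ne (ne_of_mem_of_not_mem hj hiT) _ _
  have hT'' : T' ⊆ T.erase i := fun j hj =>
    Finset.mem_erase.2 ⟨fun h => hiT' (h ▸ hj), hT' hiT hj⟩
  have hi : i ∉ T.erase i := Finset.notMem_erase i T
  rw [qDen_eq_sum, Finset.sum_eq_zero_iff_of_nonneg fun S hS => mul_nonneg
    (subsetProb_nonneg (Finset.mem_powerset.1 hS) (fun j _ => (hq j).1) fun j _ => (hq j).2)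
    (show 0 ≤ entropyGiven P (relayOut i) S from condEntropy_nonneg hP _ _)] at h0
  -- adding `Y_i` to a condition that occurs with positive probability
  have h1 : ∀ S ∈ (T.erase i).powerset, subsetProb q (T.erase i) S * entropyGiven P U (insert i S) =
      subsetProb q (T.erase i) S * entropyGiven P U S := by
    intro S hS
    by_cases hS0 : subsetProb q (T.erase i) S = 0
    · rw [hS0, zero_mul, zero_mul]
    congr 1
    replace hS0 : subsetProb q (T.erase i) S ≠ 0 := hS0
    have h2 : subsetProb q T' (S ∩ T') ≠ 0 := by
      rw [subsetProb, mul_ne_zero_iff, Finset.prod_ne_zero_iff, Finset.prod_ne_zero_iff] at hS0 ⊢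
      refine ⟨fun j hj => hS0.1 j (Finset.mem_inter.1 hj).1, fun j hj => hS0.2 j ?_⟩
      rw [Finset.mem_sdiff] at hj ⊢
      exact ⟨hT'' hj.1, fun h => hj.2 (Finset.mem_inter.2 ⟨h, hj.1⟩)⟩
    have h3 : entropyGiven P (relayOut i) (S ∩ T') = 0 :=
      (mul_eq_zero.1 (h0 _ (Finset.mem_powerset.2 Finset.inter_subset_right))).resolve_left h2
    have h4 := condEntropy_pair_eq_of_condEntropy_eq_zero hP (U := U)
      (V' := fun ω => (relayOutsOn S ω, insAndOut ω)) h3 (by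
        intro ω ω' h
        simp only [Prod.mk.injEq] at h ⊢
        rw [relayOutsOn_eq_iff] at h ⊢
        exact ⟨fun j hj => h.1 j (Finset.mem_inter.1 hj).1, h.2⟩)
    refine Eq.trans (condEntropy_congr (fun ω ω' _ _ => ?_) fun _ _ _ _ _ => Iff.rfl) h4
    simp only [Prod.mk.injEq]
    rw [relayOutsOn_eq_iff, relayOutsOn_eq_iff, Finset.forall_mem_insert, and_assoc]
  have h5 : ∀ S ∈ (T.erase i).powerset,
      subsetProb (Function.update q i 0) (T.erase i) S = subsetProb q (T.erase i) S := by
    intro S hS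
    exact subsetProb_congr (Finset.mem_powerset.1 hS) fun j hj =>
      Function.update_of_ne (Finset.ne_of_mem_erase hj) _ _
  rw [← Finset.insert_erase hiT, sum_subsetProb_insert _ hi, sum_subsetProb_insert _ hi,
    Finset.sum_congr rfl h1, Function.update_self,
    Finset.sum_congr rfl fun S hS => congrArg (· * entropyGiven P U S) (h5 S hS)]
  ring

variable {precY : Fin N → Fin N → Prop} [IsStrictOrder (Fin N) precY]

include hP in
/-- The relays whose outputs need no description at all may be removed from the masks, without a
change of the other description rates or of the rate of the source. -/
theorem qDen_eafRate_remove {q : Fin N → ℝ} (hq : ∀ i, 0 ≤ q i ∧ q i ≤ 1) (W : Finset (Fin N))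
    (hW : ∀ i ∈ W, qDen P (before precY i) q i = 0) :
    (∀ j, qDen P (before precY j) (fun i => if i ∈ W then 0 else q i) j =
      qDen P (before precY j) q j) ∧
    eafRate P (fun i => if i ∈ W then 0 else q i) = eafRate P q := by
  induction W using Finset.induction_on with
  | empty => simp
  | insert i W hi ih =>
    obtain ⟨ih1, ih2⟩ := ih fun j hj => hW j (Finset.mem_insert_of_mem hj)
    set q' : Fin N → ℝ := fun i => if i ∈ W then 0 else q i with hq'
    have hq'1 : ∀ j, 0 ≤ q' j ∧ q' j ≤ 1 := by
      intro j
      simp only [hq']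
      split_ifs
      · exact ⟨le_rfl, zero_le_one⟩
      · exact hq j
    have hupd : (fun j => if j ∈ insert i W then 0 else q j) = Function.update q' i 0 := by
      funext j
      by_cases hj : j = i
      · subst hj
        simp
      · simp [hj, hq']
    have hi0 : qDen P (before precY i) q' i = 0 := by
      rw [ih1, hW i (Finset.mem_insert_self i W)]
    rw [hupd, ← ih2]
    refine ⟨fun j => ?_, ?_⟩
    · rw [← ih1 j, qDen_eq_sum, qDen_eq_sum]
      refine sum_subsetProb_update_zero hP (relayOut j) hq'1 (not_mem_before precY i)
        (fun hij k hk => ?_) hi0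
      simp only [before, mem_filter, mem_univ, true_and] at hij hk ⊢
      exact _root_.trans hk hij
    · rw [eafRate_eq_sub_sum, eafRate_eq_sub_sum]
      congr 1
      have h := sum_subsetProb_update_zero hP (srcIn (𝒳 := 𝒳)) hq'1 (T := univ)
        (not_mem_before precY i) (fun _ => Finset.subset_univ _) hi0
      rwa [Finset.powerset_univ] at h

include hP in
theorem mem_Icc_of_eq_mul_clippedRatio {num : Fin N → ℝ} (hnum : ∀ i, 0 ≤ num i) {q : Fin N → ℝ}
    {c : Fin N → ℝ} (hc : ∀ i, 0 ≤ c i ∧ c i ≤ 1)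
    (hq : ∀ i, q i = c i * clippedRatio (num i) (qDen P (before precY i) q i)) (i : Fin N) :
    0 ≤ q i ∧ q i ≤ 1 := by
  refine (Finite.wellFounded_of_trans_of_irrefl precY).induction
    (C := fun i => 0 ≤ q i ∧ q i ≤ 1) i ?_
  intro i ih
  have h1 := clippedRatio_mem (hnum i) (qDen_nonneg hP (T := before precY i) (q := q)
    (fun j hj => ih j (by simpa [before] using hj)) i)
  rw [hq i]
  exact ⟨mul_nonneg (hc i).1 h1.1, mul_le_one₀ (hc i).2 h1.1 h1.2⟩

/-- The recursion for the mask probabilities has a solution with any prefactors `c i`. -/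
theorem exists_eq_mul_clippedRatio (num c : Fin N → ℝ) :
    ∃ q : Fin N → ℝ, ∀ i, q i = c i * clippedRatio (num i) (qDen P (before precY i) q i) := by
  classical
  have hwf := Finite.wellFounded_of_trans_of_irrefl precY
  refine ⟨hwf.fix fun i q => c i * clippedRatio (num i)
    (qDen P (before precY i) (fun j => if h : precY j i then q j h else 0) i), fun i => ?_⟩
  conv_lhs => rw [WellFounded.fix_eq]
  congr 2
  refine qDen_congr (fun j hj => ?_) i
  rw [dif_pos (by simpa [before] using hj)]

include hP in
/-- The mask probabilities may be changed slightly so that the descriptions of the relay outputs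
fit strictly into the rates of the relay words. -/
theorem exists_strictly_feasible {num : Fin N → ℝ} (hnum : ∀ i, 0 ≤ num i) {q : Fin N → ℝ}
    (hq : ∀ i, q i = clippedRatio (num i) (qDen P (before precY i) q i)) {R : ℝ}
    (hR : R < eafRate P q) :
    ∃ q' : Fin N → ℝ, (∀ i, 0 ≤ q' i ∧ q' i ≤ 1) ∧
      (∀ i, q' i ≠ 0 → 0 < num i ∧ q' i * qDen P (before precY i) q' i < num i) ∧
      R < eafRate P q' := by
  classical
  have hq01 := mem_Icc_of_eq_mul_clippedRatio hP hnum (q := q) (c := fun _ => 1)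
    (fun _ => ⟨zero_le_one, le_rfl⟩) (fun i => by rw [one_mul]; exact hq i)
  set Z : Finset (Fin N) := {i | qDen P (before precY i) q i = 0} with hZ
  obtain ⟨hden, hrate⟩ := qDen_eafRate_remove hP hq01 Z fun i hi => by simpa [hZ] using hi
  set q₁ : Fin N → ℝ := fun i => if i ∈ Z then 0 else q i with hq₁
  choose f hf using fun ε : ℝ => exists_eq_mul_clippedRatio (P := P) (precY := precY) num
    fun i => if i ∈ Z then 0 else 1 - ε
  -- the prefactors leave a margin; as they tend to `1`, induction along `precY` shows continuity,
  -- which needs the nonzero denominators outside of `Z`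
  have hlim : ∀ i, Tendsto (fun ε => f ε i) (𝓝[>] 0) (𝓝 (q₁ i)) := by
    intro i
    refine (Finite.wellFounded_of_trans_of_irrefl precY).induction
      (C := fun i => Tendsto (fun ε => f ε i) (𝓝[>] 0) (𝓝 (q₁ i))) i ?_
    intro i ih
    by_cases hi : i ∈ Z
    · have h1 : ∀ ε, f ε i = 0 := fun ε => by rw [hf, if_pos hi, zero_mul]
      simp only [h1, hq₁, if_pos hi]
      exact tendsto_const_nhds
    · have hne : qDen P (before precY i) q₁ i ≠ 0 := by
        rw [hden i]
        simpa [hZ] using hi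
      have h1 := tendsto_clippedRatio (num i) hne (tendsto_qDen (P := P) (T := before precY i)
        (fun j hj => ih j (by simpa [before] using hj)) i)
      have h2 : Tendsto (fun ε : ℝ => 1 - ε) (𝓝[>] 0) (𝓝 (1 - 0)) :=
        tendsto_const_nhds.sub (tendsto_nhdsWithin_of_tendsto_nhds tendsto_id)
      have h3 := h2.mul h1
      rw [hden i, ← hq i, sub_zero, one_mul] at h3
      have h4 : q₁ i = q i := if_neg hi
      rw [h4]
      refine h3.congr fun ε => ?_
      rw [hf ε i, if_neg hi]
  have hdpos : ∀ᶠ ε in 𝓝[>] (0 : ℝ), ∀ i, i ∉ Z → 0 < qDen P (before precY i) (f ε) i := by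
    refine eventually_all.2 fun i => ?_
    by_cases hi : i ∈ Z
    · exact Eventually.of_forall fun ε h => absurd hi h
    · have hne : qDen P (before precY i) q₁ i ≠ 0 := by
        rw [hden i]
        simpa [hZ] using hi
      have hpos : 0 < qDen P (before precY i) q₁ i := by
        refine lt_of_le_of_ne ?_ hne.symm
        rw [hden i]
        exact qDen_nonneg hP (fun j _ => hq01 j) i
      filter_upwards [(tendsto_qDen (P := P) (T := before precY i) (fun j _ => hlim j)
        i).eventually_const_lt hpos] with ε h _ using h
  have hrate' : ∀ᶠ ε in 𝓝[>] (0 : ℝ), R < eafRate P (f ε) :=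
    (tendsto_eafRate hlim).eventually_const_lt (by rwa [hrate])
  have hε1 : ∀ᶠ ε in 𝓝[>] (0 : ℝ), ε < 1 :=
    nhdsWithin_le_nhds (eventually_lt_nhds one_pos)
  obtain ⟨ε, hd, hr, h1, h0⟩ := (hdpos.and (hrate'.and (hε1.and self_mem_nhdsWithin))).exists
  have h0 : 0 < ε := h0
  have hf01 := mem_Icc_of_eq_mul_clippedRatio hP hnum (q := f ε)
    (c := fun i => if i ∈ Z then 0 else 1 - ε) (fun i => by
      split_ifs
      · exact ⟨le_rfl, zero_le_one⟩
      · exact ⟨by linarith, by linarith⟩) (hf ε)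
  refine ⟨f ε, hf01, fun i hi => ?_, hr⟩
  have hfi := hf ε i
  have hiZ : i ∉ Z := fun h => hi (by rw [hfi, if_pos h, zero_mul])
  have hdi := hd i hiZ
  rw [if_neg hiZ, clippedRatio, if_neg hdi.ne'] at hfi
  have hnpos : 0 < num i := by
    refine lt_of_le_of_ne (hnum i) fun h => hi ?_
    rw [hfi, ← h]
    simp
  refine ⟨hnpos, ?_⟩
  have h2 : min (num i / qDen P (before precY i) (f ε) i) 1 * qDen P (before precY i) (f ε) i ≤
      num i := by
    refine (mul_le_mul_of_nonneg_right (min_le_left _ _) hdi.le).trans_eq ?_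
    rw [div_mul_cancel₀ _ hdi.ne']
  generalize min (num i / qDen P (before precY i) (f ε) i) 1 = m at hfi h2
  rw [hfi, mul_assoc]
  nlinarith

end Perturbation

/-! ### Achievability -/

section Achievability

variable {N : ℕ} {𝒳 𝒴 : Type*} {𝒳r 𝒴r : Fin N → Type*}

theorem nonempty_of_mem_stdSimplex {α : Type*} [Fintype α] {p : α → ℝ} (hp : p ∈ stdSimplex ℝ α) :
    Nonempty α := by
  obtain ⟨a, -, -⟩ := Finset.exists_ne_zero_of_sum_ne_zero (hp.2.trans_ne one_ne_zero)
  exact ⟨a⟩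

variable [Fintype 𝒴] [∀ i, Fintype (𝒴r i)] (ch : RelayChannel 𝒳 𝒴 𝒳r 𝒴r)

/-- It suffices to find good codes for every error level and all large block lengths. -/
theorem achievable_of_forall_eventually {R : ℝ} (x₀ : 𝒳) (xr₀ : ∀ i, 𝒳r i)
    (h : ∀ ε > 0, ∀ᶠ n : ℕ in atTop,
      ∃ c : RelayCode 𝒳 𝒴 𝒳r 𝒴r ⌈(2 : ℝ) ^ ((n : ℝ) * R)⌉₊ n, ch.errorProb c ≤ ε) :
    ch.Achievable R := by
  set E : ℕ → Set ℝ := fun n =>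
    Set.range fun c : RelayCode 𝒳 𝒴 𝒳r 𝒴r ⌈(2 : ℝ) ^ ((n : ℝ) * R)⌉₊ n => ch.errorProb c with hE
  have hne : ∀ n, (E n).Nonempty := fun n =>
    ⟨_, ⟨fun _ _ => x₀, fun i _ _ => xr₀ i, fun _ => ⟨0, Nat.ceil_pos.2 (two_rpow_pos _)⟩⟩, rfl⟩
  have hbdd : ∀ n, BddBelow (E n) := fun n =>
    ⟨0, by rintro _ ⟨c, rfl⟩; exact ch.errorProb_nonneg c⟩
  -- a code whose error probability is close to the infimum, for each block length
  have hc : ∀ n : ℕ, ∃ c : RelayCode 𝒳 𝒴 𝒳r 𝒴r ⌈(2 : ℝ) ^ ((n : ℝ) * R)⌉₊ n,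
      ch.errorProb c < sInf (E n) + 1 / ((n : ℝ) + 1) := by
    intro n
    obtain ⟨_, ⟨c, rfl⟩, hc⟩ := exists_lt_of_csInf_lt (hne n)
      (lt_add_of_pos_right (sInf (E n)) (Nat.one_div_pos_of_nat (α := ℝ) (n := n)))
    exact ⟨c, hc⟩
  choose c hc using hc
  refine ⟨c, tendsto_order.2 ⟨fun a ha =>
    Eventually.of_forall fun n => ha.trans_le (ch.errorProb_nonneg _), fun a ha => ?_⟩⟩
  filter_upwards [h (a / 2) (half_pos ha),
    tendsto_one_div_add_atTop_nhds_zero_nat.eventually_lt_const (half_pos ha)] with n hn hn'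
  obtain ⟨c', hc'⟩ := hn
  have h1 : sInf (E n) ≤ a / 2 := (csInf_le (hbdd n) ⟨c', rfl⟩).trans hc'
  linarith [hc n]

/-- Messages can be written with `B` digits from an alphabet of size `M`; the digits at the places
from `B` on are idle. -/
theorem exists_digits {K M B : ℕ} (hM : 0 < M) (h : K ≤ M ^ B) :
    ∃ φ : Fin K → ℕ → Fin M, ∀ w w', (∀ j < B, φ w j = φ w' j) → w = w' := by
  refine ⟨fun w j => if hj : j < B then finFunctionFinEquiv.symm (Fin.castLE h w) ⟨j, hj⟩
    else ⟨0, hM⟩, fun w w' hw => ?_⟩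
  have h1 : finFunctionFinEquiv.symm (Fin.castLE h w) =
      finFunctionFinEquiv.symm (Fin.castLE h w') := by
    funext j
    have := hw j j.2
    simpa [j.2] using this
  exact Fin.castLE_injective h (finFunctionFinEquiv.symm.injective h1)

/-- At a negative rate there is only one message. -/
theorem exists_errorProb_le_of_neg {R : ℝ} (hR : R < 0) (x₀ : 𝒳) (xr₀ : ∀ i, 𝒳r i) (n : ℕ) :
    ∃ c : RelayCode 𝒳 𝒴 𝒳r 𝒴r ⌈(2 : ℝ) ^ ((n : ℝ) * R)⌉₊ n, ch.errorProb c ≤ 0 := by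
  have h1 : ⌈(2 : ℝ) ^ ((n : ℝ) * R)⌉₊ ≤ 1 := by
    rw [Nat.ceil_le, Nat.cast_one]
    exact Real.rpow_le_one_of_one_le_of_nonpos one_le_two
      (mul_nonpos_of_nonneg_of_nonpos (Nat.cast_nonneg n) hR.le)
  refine ⟨⟨fun _ _ => x₀, fun i _ _ => xr₀ i, fun _ => ⟨0, Nat.ceil_pos.2 (two_rpow_pos _)⟩⟩, ?_⟩
  refine (div_eq_zero_iff.2 (Or.inl ?_)).le
  refine Finset.sum_eq_zero fun w _ => Finset.sum_eq_zero fun ω _ => if_neg (not_not.2 ?_)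
  exact Fin.ext (by have := w.2; omega)

variable [Fintype 𝒳] [∀ i, Fintype (𝒳r i)] {p : 𝒳 → ℝ} (hp : p ∈ stdSimplex ℝ 𝒳)
  {pr : ∀ i, 𝒳r i → ℝ} (hpr : ∀ i, pr i ∈ stdSimplex ℝ (𝒳r i))
  {precX precY : Fin N → Fin N → Prop} [IsStrictOrder (Fin N) precX] [IsStrictOrder (Fin N) precY]

include hp hpr in
/-- Rates for the relays and exponents for the tests exist if the masks are strictly feasible; the
error probability of random codes for one block then tends to `0`. -/
theorem exists_tests_tendsto {q : Fin N → ℝ} (hq : ∀ i, 0 ≤ q i ∧ q i ≤ 1)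
    (hfeas : ∀ i, q i ≠ 0 → 0 < qNum (ch.joint p pr) (before precX i) i ∧
      q i * qDen (ch.joint p pr) (before precY i) q i <
        qNum (ch.joint p pr) (before precX i) i) {R : ℝ} (hR : 0 ≤ R)
    (hRq : R < eafRate (ch.joint p pr) q) (y₀ : ∀ i, 𝒴r i) :
    ∃ (t : Tests 𝒳 𝒴 𝒳r 𝒴r precX precY) (L : ℕ → Fin N → ℕ) (ε : ℕ → ℝ),
      Tendsto ε atTop (𝓝 0) ∧ (∀ n i, 0 < L n i) ∧
      ∀ (n : ℕ) (s : ∀ i, Fin (L n i)) (w : Fin ⌈(2 : ℝ) ^ (n * R)⌉₊),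
      codeExpect q p pr (fun D : BlockCode 𝒳 𝒳r 𝒴r n ⌈(2 : ℝ) ^ (n * R)⌉₊ (L n) =>
        expect (D.prob ch s w) fun ω => ind (¬t.Good y₀ D s ω w)) ≤ ε n := by
  obtain ⟨c, hc1, hc2⟩ := exists_between hRq
  -- exponents `a`, `b` below the expected logarithms, with room for a relay rate `r`
  have hrates : ∀ i, ∃ a b r : ℝ, a < qNum (ch.joint p pr) (before precX i) i ∧
      b < -(q i * qDen (ch.joint p pr) (before precY i) q i) ∧
      (q i ≠ 0 → 0 ≤ r ∧ r < a ∧ -r < b) := by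
    intro i
    by_cases hi : q i = 0
    · obtain ⟨a, ha⟩ := exists_lt (qNum (ch.joint p pr) (before precX i) i)
      obtain ⟨b, hb⟩ := exists_lt (-(q i * qDen (ch.joint p pr) (before precY i) q i))
      exact ⟨a, b, 0, ha, hb, fun h => absurd hi h⟩
    · obtain ⟨-, h2⟩ := hfeas i hi
      have h0 : 0 ≤ q i * qDen (ch.joint p pr) (before precY i) q i :=
        mul_nonneg (hq i).1 (qDen_nonneg (joint_nonneg ch hp hpr) (fun j _ => hq j) i)
      obtain ⟨r, hr1, hr2⟩ := exists_between h2
      obtain ⟨a, ha1, ha2⟩ := exists_between hr2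
      obtain ⟨b, hb1, hb2⟩ := exists_between (neg_lt_neg hr1)
      exact ⟨a, b, r, ha2, hb2, fun _ => ⟨h0.trans hr1.le, ha1, hb1⟩⟩
  choose a b r ha hb hr using hrates
  obtain ⟨ε, hε, hle⟩ := exists_tendsto_codeExpect_le (R := R) ch hq hp hpr
    (likelihoodTests_normalized ch hp hpr y₀ (precX := precX) (precY := precY) (c := c))
    (likelihoodTests_reliable ch hp hpr y₀ ha hb hc2) hR hc1 hr
  exact ⟨_, relayCard q r, ε, hε, relayCard_pos q r, hle⟩

include hp hpr in
/-- Block Markov coding: one block more than the number of digits of the message, so that the loss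
of rate is arbitrarily small. -/
theorem eventually_exists_errorProb_le {q : Fin N → ℝ} (hq : ∀ i, 0 ≤ q i ∧ q i ≤ 1)
    (hfeas : ∀ i, q i ≠ 0 → 0 < qNum (ch.joint p pr) (before precX i) i ∧
      q i * qDen (ch.joint p pr) (before precY i) q i <
        qNum (ch.joint p pr) (before precX i) i) {R : ℝ} (hR : 0 ≤ R)
    (hRq : R < eafRate (ch.joint p pr) q) {δ : ℝ} (hδ : 0 < δ) :
    ∀ᶠ n : ℕ in atTop,
      ∃ c : RelayCode 𝒳 𝒴 𝒳r 𝒴r ⌈(2 : ℝ) ^ ((n : ℝ) * R)⌉₊ n, ch.errorProb c ≤ δ := by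
  obtain ⟨x₀⟩ := nonempty_of_mem_stdSimplex hp
  have xr₀ : ∀ i, 𝒳r i := fun i => (nonempty_of_mem_stdSimplex (hpr i)).some
  obtain ⟨-, y₀⟩ := nonempty_of_mem_stdSimplex (ch.prob_mem x₀ xr₀)
  obtain ⟨R', hR1, hR2⟩ := exists_between hRq
  obtain ⟨t, L, ε, hε, hL, hcode⟩ := exists_tests_tendsto ch hp hpr hq hfeas (hR.trans hR1.le)
    hR2 y₀
  -- `B` blocks of rate `R'` carry more than `B + 1` blocks of rate `R`
  obtain ⟨B, hB⟩ := exists_nat_gt (R / (R' - R))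
  have hgap : 0 < B * R' - (B + 1) * R := by
    rw [div_lt_iff₀ (sub_pos.2 hR1)] at hB
    linarith
  obtain ⟨n₀, hn₀⟩ := exists_nat_ge (B * R / (B * R' - (B + 1) * R))
  have hdiv : Tendsto (fun n : ℕ => n / (B + 1)) atTop atTop :=
    Nat.tendsto_div_const_atTop B.succ_ne_zero
  have hε' : ∀ᶠ n in atTop, (B + 1) * ε n < δ := by
    have := hε.const_mul ((B : ℝ) + 1)
    rw [mul_zero] at this
    exact this.eventually_lt_const hδ
  filter_upwards [hdiv.eventually hε', hdiv.eventually (eventually_ge_atTop n₀)] with n' h1 h2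
  set n := n' / (B + 1) with hn
  set K := ⌈(2 : ℝ) ^ ((n' : ℝ) * R)⌉₊ with hK
  set M := ⌈(2 : ℝ) ^ ((n : ℝ) * R')⌉₊ with hM
  have hlen : n * B + n + n' % (B + 1) = n' := by
    have := Nat.div_add_mod n' (B + 1)
    rw [← hn] at this
    linarith
  have hKpos : 0 < K := Nat.ceil_pos.2 (two_rpow_pos _)
  have hKM : K ≤ M ^ B := by
    refine Nat.ceil_le.2 ?_
    rw [Nat.cast_pow]
    refine le_trans ?_ (pow_le_pow_left₀ (two_rpow_pos _).le (Nat.le_ceil _) B)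
    rw [← Real.rpow_mul_natCast two_pos.le]
    refine Real.rpow_le_rpow_of_exponent_le one_le_two ?_
    have hmod : ((n' % (B + 1) : ℕ) : ℝ) ≤ B := by
      exact_mod_cast Nat.lt_succ_iff.1 (Nat.mod_lt n' B.succ_pos)
    have hlen' : (n' : ℝ) = n * B + n + (n' % (B + 1) : ℕ) := by exact_mod_cast hlen.symm
    have h3 : B * R ≤ n * (B * R' - (B + 1) * R) := by
      rw [div_le_iff₀ hgap] at hn₀
      exact hn₀.trans (mul_le_mul_of_nonneg_right (by exact_mod_cast h2) hgap.le)
    have h4 := mul_le_mul_of_nonneg_right hmod hR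
    calc (n' : ℝ) * R = n * (B + 1) * R + (n' % (B + 1) : ℕ) * R := by rw [hlen']; ring
      _ ≤ n * R' * B := by linarith
  obtain ⟨φ, hφ⟩ := exists_digits (Nat.ceil_pos.2 (two_rpow_pos (n * R'))) hKM
  have hblock : ∀ (m : ℕ) (μ : Fin K × (Fin m → 𝒴 × (∀ i, 𝒴r i)) → ℝ) (_ : ∀ x, 0 ≤ μ x)
      (s : Fin K × (Fin m → 𝒴 × (∀ i, 𝒴r i)) → ∀ i, Fin (L n i))
      (w : Fin K × (Fin m → 𝒴 × (∀ i, 𝒴r i)) → Fin M),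
      ∃ D : BlockCode 𝒳 𝒳r 𝒴r n M (L n), ∑ x, μ x * expect (D.prob ch (s x) (w x))
        (fun ω => ind (¬t.Good y₀ D (s x) ω (w x))) ≤ ε n * ∑ x, μ x :=
    fun m μ hμ s w => exists_blockCode_le ch hq hp hpr (hL n) (hcode n) μ hμ s w
  obtain ⟨c, σ, G, hc⟩ := exists_transmitsDigits (ch := ch) (hL n) hKpos (φ := φ) hblock B
  -- one more block, whose own digit is idle, delivers the last indices
  obtain ⟨c', σ', G', hc', huniq⟩ := hc.append (hblock _)
  have hfail := hc'.fail_le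
  rw [show (B : ℝ) * (ε n * K) + ε n * K = (B + 1) * ε n * K by ring] at hfail
  obtain ⟨c'', hc''⟩ := exists_errorProb_le_of_unique c' G' hfail hKpos
    (fun w w' ω ω' hg hg' hy => hφ w w' (huniq w w' ω ω' hg hg' hy)) x₀ xr₀ (n' % (B + 1))
  have hcast : ∀ m, m = n' → (∃ c : RelayCode 𝒳 𝒴 𝒳r 𝒴r K m, ch.errorProb c ≤ δ) →
      ∃ c : RelayCode 𝒳 𝒴 𝒳r 𝒴r K n', ch.errorProb c ≤ δ := by
    rintro m rfl h
    exact h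
  exact hcast _ hlen ⟨c'', hc''.trans h1.le⟩

end Achievability

end MultiRelay

theorem mainTheorem1 {N : ℕ} {𝒳 𝒴 : Type*} {𝒳r 𝒴r : Fin N → Type*}
    [Fintype 𝒳] [Fintype 𝒴] [∀ i, Fintype (𝒳r i)] [∀ i, Fintype (𝒴r i)]
    (ch : MultiRelay.RelayChannel 𝒳 𝒴 𝒳r 𝒴r)
    (p : 𝒳 → ℝ) (hp : p ∈ stdSimplex ℝ 𝒳)
    (pr : ∀ i, 𝒳r i → ℝ) (hpr : ∀ i, pr i ∈ stdSimplex ℝ (𝒳r i))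
    (precX precY : Fin N → Fin N → Prop)
    [IsStrictOrder (Fin N) precX] [IsStrictOrder (Fin N) precY]
    (R : ℝ)
    (hR : R < MultiRelay.eafRate (ch.joint p pr)
      (MultiRelay.timeShare (ch.joint p pr) precX precY)) :
    ch.Achievable R := by
  obtain ⟨x₀⟩ := MultiRelay.nonempty_of_mem_stdSimplex hp
  have xr₀ : ∀ i, 𝒳r i := fun i => (MultiRelay.nonempty_of_mem_stdSimplex (hpr i)).some
  have hP := MultiRelay.joint_nonneg ch hp hpr
  by_cases hR0 : R < 0
  · refine MultiRelay.achievable_of_forall_eventually ch x₀ xr₀ fun ε hε =>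
      Eventually.of_forall fun n => ?_
    obtain ⟨c, hc⟩ := MultiRelay.exists_errorProb_le_of_neg ch hR0 x₀ xr₀ n
    exact ⟨c, hc.trans hε.le⟩
  · obtain ⟨q, hq, hfeas, hRq⟩ := MultiRelay.exists_strictly_feasible hP
      (num := fun i => MultiRelay.qNum (ch.joint p pr) (MultiRelay.before precX i) i)
      (fun i => MultiRelay.qNum_nonneg ch hp hpr (MultiRelay.not_mem_before precX i))
      (fun i => MultiRelay.timeShare_eq (ch.joint p pr) precX precY i) hR
    exact MultiRelay.achievable_of_forall_eventually ch x₀ xr₀ fun ε hε =>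
      MultiRelay.eventually_exists_errorProb_le ch hp hpr hq hfeas (not_lt.1 hR0) hRq hε
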